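/- All graphs are finite and simple. A star $k$-edge coloring of a graph $G$ is a proper edge coloring of $G$ with colors from $\{1,\dots,k\}$ such that no path and no cycle with four edges is bi-colored (uses only two colors); the star chromatic index $\chi'_{st}(G)$ is the smallest $k$ for which $G$ has a star $k$-edge coloring. A cubic Halin graph $G=T\cup C$ is a plane graph consisting of a plane embedding of a tree $T$, in which every vertex that is not a leaf has degree exactly $3$, and a cycle $C$ passing through exactly the leaves of $T$ such that $C$ is the boundary of the exterior face; $T$ is called the characteristic tree of $G$. A caterpillar is a tree such that the removal of all its leaves results in a path. Let $\mathcal{G}_h$ be the set of all cubic Halin graphs whose characteristic trees are caterpillars with $h+2$ leaves. Let $N_{e_2}$ be the graph with vertices $v_1,v_2,u_0,u_1,u_2,u_3$ and edges $v_1v_2$, $v_1u_0$, $v_1u_1$, $v_2u_2$, $v_2u_3$, $u_0u_1$, $u_1u_2$, $u_2u_3$, $u_3u_0$ (the triangular prism). **Theorem.** Let $h$ be a positive integer and let $G=T\cup C\in\mathcal{G}_h$. If $G$ is not isomorphic to $N_{e_2}$, then $\chi'_{st}(G)=5$. -/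

import Mathlib

namespace HalinStar

variable {V : Type*}

/-! ### Star edge colorings -/

/-- Along the walk `p`, the edge coloring `c` uses no color outside some pair `{a, b}`.
(For a proper coloring and a walk containing two adjacent edges this means exactly two colors.) -/
def IsBicolored {G : SimpleGraph V} {k : ℕ} (c : G.edgeSet → Fin k) {u v : V}
    (p : G.Walk u v) : Prop :=
  ∃ a b : Fin k, ∀ e : G.edgeSet, (e : Sym2 V) ∈ p.edges → c e = a ∨ c e = b

/-- A proper edge coloring (a vertex coloring of the line graph) is a star edge coloring if no path
and no cycle with four edges is bicolored. -/
def IsStarEdgeColoring {G : SimpleGraph V} {k : ℕ} (c : G.lineGraph.Coloring (Fin k)) : Prop :=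
  (∀ (u v : V) (p : G.Walk u v), p.IsPath → p.length = 4 → ¬ IsBicolored (fun e => c e) p) ∧
  (∀ (u : V) (p : G.Walk u u), p.IsCycle → p.length = 4 → ¬ IsBicolored (fun e => c e) p)

/-- The graph has a star edge coloring with colors from a set of size `k`. -/
def StarEdgeColorable (G : SimpleGraph V) (k : ℕ) : Prop :=
  ∃ c : G.lineGraph.Coloring (Fin k), IsStarEdgeColoring c

/-- The star chromatic index: the least `k` such that a star `k`-edge coloring exists (one always
exists for a finite graph; the value `5` is never the default value of `sInf`). -/
noncomputable def starChromaticIndex (G : SimpleGraph V) : ℕ :=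
  sInf {k : ℕ | StarEdgeColorable G k}

/-! ### Plane embeddings, given combinatorially by rotation systems of genus zero -/

/-- A rotation system: for every vertex a cyclic order of the darts (oriented edges) leaving it. -/
structure RotationSystem (G : SimpleGraph V) where
  /-- the next dart around the same vertex -/
  rot : Equiv.Perm G.Dart
  rot_fst : ∀ d, (rot d).fst = d.fst
  cyclic : ∀ d d' : G.Dart, d.fst = d'.fst → rot.SameCycle d d'

/-- The face permutation: walk along the dart `d`, then leave its end by the dart which follows the
reversal of `d` in the rotation. Its cycles are the facial walks. -/
def RotationSystem.faceMap {G : SimpleGraph V} (R : RotationSystem G) : Equiv.Perm G.Dart :=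
  R.rot * Function.Involutive.toPerm SimpleGraph.Dart.symm SimpleGraph.Dart.symm_involutive

/-- The faces of the embedding: the cycles of the face permutation. -/
def RotationSystem.Face {G : SimpleGraph V} (R : RotationSystem G) : Type _ :=
  Quotient (Equiv.Perm.SameCycle.setoid R.faceMap)

/-- The rotation system of a connected finite graph with at least one edge describes an embedding in
the plane (equivalently the sphere): its Euler characteristic `|V| - |E| + |F|` is two. -/
def RotationSystem.IsPlane {G : SimpleGraph V} (R : RotationSystem G) : Prop :=
  G.Connected ∧ Nat.card V + Nat.card R.Face = G.edgeSet.ncard + 2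

/-! ### Halin graphs -/

/-- The degree of `v` in `T`. -/
noncomputable def deg (T : SimpleGraph V) (v : V) : ℕ := (T.neighborSet v).ncard

/-- `G = T ∪ C` is a Halin graph with characteristic tree `T` and cycle `C`: `T` is a tree without
vertices of degree two, `C` is a cycle through exactly the leaves of `T`, and `G` has a plane
embedding one of whose facial walks is `C`. (Any face of an embedding in the sphere may be taken as
the exterior face.) -/
structure IsHalin (G T : SimpleGraph V) {r : V} (C : G.Walk r r) : Prop where
  isTree : T.IsTree
  deg_ne_two : ∀ v, deg T v ≠ 2
  isCycle : C.IsCycle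
  mem_cycle : ∀ v, v ∈ C.support ↔ deg T v = 1
  union : ∀ e, e ∈ G.edgeSet ↔ e ∈ T.edgeSet ∨ e ∈ C.edges
  plane : ∃ R : RotationSystem G, R.IsPlane ∧
    ∃ d₀ : G.Dart, ∀ d : G.Dart, d ∈ C.darts ↔ R.faceMap.SameCycle d₀ d

/-- `G = T ∪ C` is a cubic Halin graph: every non-leaf of `T` has degree three in `T`. -/
structure IsCubicHalin (G T : SimpleGraph V) {r : V} (C : G.Walk r r) : Prop where
  isHalin : IsHalin G T C
  deg_eq_three : ∀ v, deg T v ≠ 1 → deg T v = 3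

/-- A caterpillar: a tree such that removing all its leaves results in a path. -/
def IsCaterpillar (T : SimpleGraph V) : Prop :=
  T.IsTree ∧ ∃ n : ℕ, Nonempty (T.induce {v | deg T v ≠ 1} ≃g SimpleGraph.pathGraph n)

/-- The class `𝒢_h` of cubic Halin graphs whose characteristic tree is a caterpillar with `h + 2`
leaves. -/
def CaterpillarHalin (h : ℕ) (G : SimpleGraph V) : Prop :=
  ∃ (T : SimpleGraph V) (r : V) (C : G.Walk r r),
    IsCubicHalin G T C ∧ IsCaterpillar T ∧ {v | deg T v = 1}.ncard = h + 2

/-- The necklace `N_{e_h}` (`h ≥ 1`): a spine `v₁ … v_h` (`Sum.inl i` is `v_{i+1}`), a cycle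
`u₀ u₁ … u_{h+1} u₀` (`Sum.inr k` is `u_k`), the edges `v_i u_i` for `1 ≤ i ≤ h`, and the two further
edges `v₁ u₀` and `v_h u_{h+1}`. -/
def necklace (h : ℕ) : SimpleGraph (Fin h ⊕ Fin (h + 2)) :=
  SimpleGraph.fromRel fun x y => match x, y with
    | .inl i, .inl j => i.val + 1 = j.val
    | .inl i, .inr k => k.val = i.val + 1 ∨ (i.val = 0 ∧ k.val = 0) ∨
        (i.val + 1 = h ∧ k.val = h + 1)
    | .inr k, .inr l => k.val + 1 = l.val ∨ (k.val = h + 1 ∧ l.val = 0)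
    | .inr _, .inl _ => False

end HalinStar

/-!
Choose a leaf at either end of the caterpillar as a pole and extend the spine to the poles. A cut
between two consecutive rungs meets three strands: the spine and the two rails, which are the arcs
of the outer cycle between the poles. Whether a star coloring on the left of the cut extends to the
right depends only on the *front*: the colors of the three cut edges, those around their left ends,
and those forbidden around their right ends. There is a front with five colors which recurs, up to
renaming colors and exchanging the rails, after any two rungs, wherever these are attached. Hence
sweeping from one pole to the other colors every graph except, for two rungs, the prism.

That the rails are arcs of the outer cycle follows from Euler's formula: there are as many bounded
faces as outer edges, and every facial walk reaches a leaf, so that each bounded face contains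
exactly one outer edge.

With only four colors, each vertex of a cubic graph misses exactly one color. Going around a
triangle, the missing colors force a bi-colored walk with four edges.
-/

namespace HalinStar

section Coloring

variable {V W α : Type*} {G : SimpleGraph V}

/-! ### Star colorings as functions on pairs of vertices -/

/-- A star edge coloring, encoded as a function on all unordered pairs of vertices; its values at
pairs which are not edges are irrelevant. Paths and cycles with four edges are treated together, as
the walks `p₀ p₁ p₂ p₃ p₄` without immediate reversals. -/
structure IsStarColoring (G : SimpleGraph V) (c : Sym2 V → α) : Prop where
  proper : ∀ ⦃v x y⦄, G.Adj v x → G.Adj v y → x ≠ y → c s(v, x) ≠ c s(v, y)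
  not_alternating : ∀ ⦃p₀ p₁ p₂ p₃ p₄⦄,
    G.Adj p₀ p₁ → G.Adj p₁ p₂ → G.Adj p₂ p₃ → G.Adj p₃ p₄ → p₀ ≠ p₂ → p₁ ≠ p₃ → p₂ ≠ p₄ →
    c s(p₀, p₁) = c s(p₂, p₃) → c s(p₁, p₂) ≠ c s(p₃, p₄)

theorem IsStarColoring.proper_swap {c : Sym2 V → α} (hc : IsStarColoring G c) {v x y : V}
    (hx : G.Adj x v) (hy : G.Adj v y) (hxy : x ≠ y) : c s(x, v) ≠ c s(v, y) :=
  Sym2.eq_swap (a := x) ▸ hc.proper hx.symm hy hxy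

theorem IsStarColoring.comap {H : SimpleGraph W} {c : Sym2 W → α} (hc : IsStarColoring H c)
    (f : G →g H) (hf : Function.Injective f) : IsStarColoring G (c ∘ Sym2.map f) where
  proper _ _ _ hx hy hxy := hc.proper (f.map_adj hx) (f.map_adj hy) (hf.ne hxy)
  not_alternating _ _ _ _ _ h₁ h₂ h₃ h₄ n₁ n₂ n₃ :=
    hc.not_alternating (f.map_adj h₁) (f.map_adj h₂) (f.map_adj h₃) (f.map_adj h₄)
      (hf.ne n₁) (hf.ne n₂) (hf.ne n₃)

theorem IsStarColoring.not_isBicolored {k : ℕ} {c : Sym2 V → Fin k} (hc : IsStarColoring G c)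
    {u v : V} {p : G.Walk u v} (hp : p.IsTrail) (hl : p.length = 4) :
    ¬ IsBicolored (fun e : G.edgeSet => c e) p := by
  rintro ⟨a, b, hab⟩
  match p, hp, hl, hab with
  | .cons (v := p₁) h₁ (.cons (v := p₂) h₂ (.cons (v := p₃) h₃ (.cons h₄ .nil))), hp, _, hab =>
    have c₁ := hab ⟨s(_, _), h₁⟩ (by simp)
    have c₂ := hab ⟨s(_, _), h₂⟩ (by simp)
    have c₃ := hab ⟨s(_, _), h₃⟩ (by simp)
    have c₄ := hab ⟨s(_, _), h₄⟩ (by simp)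
    have hne := hp.edges_nodup
    simp only [SimpleGraph.Walk.edges_cons, SimpleGraph.Walk.edges_nil, List.nodup_cons,
      List.mem_cons, Sym2.eq_iff, not_or, not_and_or] at hne
    have n₁ : u ≠ p₂ := by grind
    have n₂ : p₁ ≠ p₃ := by grind
    have n₃ : p₂ ≠ v := by grind
    have e₁ := hc.proper_swap h₁ h₂ n₁
    have e₂ := hc.proper_swap h₂ h₃ n₂
    have e₃ := hc.proper_swap h₃ h₄ n₃
    have := hc.not_alternating h₁ h₂ h₃ h₄ n₁ n₂ n₃
    grind

theorem IsStarColoring.starEdgeColorable {k : ℕ} {c : Sym2 V → Fin k} (hc : IsStarColoring G c) :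
    StarEdgeColorable G k := by
  refine ⟨SimpleGraph.Coloring.mk (fun e => c e) ?_,
    fun _ _ _ hp hl => hc.not_isBicolored hp.isTrail hl,
    fun _ _ hp hl => hc.not_isBicolored hp.isTrail hl⟩
  rintro ⟨_, he⟩ ⟨_, he'⟩ hadj
  obtain ⟨hne, v, ⟨x, rfl⟩, ⟨y, rfl⟩⟩ := SimpleGraph.lineGraph_adj_iff_exists.1 hadj
  exact hc.proper he he' fun h => hne (by subst h; rfl)

theorem IsStarEdgeColoring.not_alternating {k : ℕ} {c : G.lineGraph.Coloring (Fin k)}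
    (hc : IsStarEdgeColoring c) {p₀ p₁ p₂ p₃ p₄ : V} (h₁ : G.Adj p₀ p₁) (h₂ : G.Adj p₁ p₂)
    (h₃ : G.Adj p₂ p₃) (h₄ : G.Adj p₃ p₄) (n₀₂ : p₀ ≠ p₂) (n₀₃ : p₀ ≠ p₃) (n₁₃ : p₁ ≠ p₃)
    (n₁₄ : p₁ ≠ p₄) (n₂₄ : p₂ ≠ p₄) (h₁₃ : c ⟨s(p₀, p₁), h₁⟩ = c ⟨s(p₂, p₃), h₃⟩) :
    c ⟨s(p₁, p₂), h₂⟩ ≠ c ⟨s(p₃, p₄), h₄⟩ := by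
  intro h₂₄
  have hne := And.intro (And.intro h₁.ne h₂.ne) (And.intro h₃.ne h₄.ne)
  have bicolored : ∀ e : G.edgeSet, (e : Sym2 V) ∈ [s(p₀, p₁), s(p₁, p₂), s(p₂, p₃), s(p₃, p₄)] →
      c e = c ⟨s(p₀, p₁), h₁⟩ ∨ c e = c ⟨s(p₁, p₂), h₂⟩ := by
    rintro ⟨e, he⟩ hmem
    simp only [List.mem_cons, List.not_mem_nil, or_false] at hmem
    rcases hmem with rfl | rfl | rfl | rfl
    exacts [.inl rfl, .inr rfl, .inl h₁₃.symm, .inr h₂₄.symm]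
  by_cases h₀₄ : p₀ = p₄
  · subst h₀₄
    refine hc.2 p₀ (.cons h₁ (.cons h₂ (.cons h₃ (.cons h₄ .nil)))) ?_ rfl ⟨_, _, bicolored⟩
    simp only [SimpleGraph.Walk.cons_isCycle_iff, SimpleGraph.Walk.isPath_def,
      SimpleGraph.Walk.support_cons, SimpleGraph.Walk.support_nil, SimpleGraph.Walk.edges_cons,
      SimpleGraph.Walk.edges_nil]
    grind
  · refine hc.1 p₀ p₄ (.cons h₁ (.cons h₂ (.cons h₃ (.cons h₄ .nil)))) ?_ rfl ⟨_, _, bicolored⟩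
    simp only [SimpleGraph.Walk.isPath_def, SimpleGraph.Walk.support_cons,
      SimpleGraph.Walk.support_nil]
    grind

theorem StarEdgeColorable.exists_isStarColoring [Nonempty α] {k : ℕ} (h : StarEdgeColorable G k)
    (ι : Fin k ↪ α) : ∃ c : Sym2 V → α, IsStarColoring G c := by
  classical
  obtain ⟨c, hc⟩ := h
  let d : Sym2 V → α := fun e => if he : e ∈ G.edgeSet then ι (c ⟨e, he⟩) else Classical.arbitrary α
  have d_inj : ∀ {e e'} (he : e ∈ G.edgeSet) (he' : e' ∈ G.edgeSet), d e = d e' →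
      c ⟨e, he⟩ = c ⟨e', he'⟩ := by
    intro e e' he he' h
    simpa only [d, dif_pos he, dif_pos he', ι.injective.eq_iff] using h
  have proper : ∀ ⦃v x y⦄, G.Adj v x → G.Adj v y → x ≠ y → d s(v, x) ≠ d s(v, y) := by
    intro v x y hx hy hxy heq
    refine c.valid (SimpleGraph.lineGraph_adj_iff_exists.2
      ⟨fun h => hxy ?_, v, Sym2.mem_mk_left v x, Sym2.mem_mk_left v y⟩) (d_inj hx hy heq)
    exact Sym2.congr_right.1 (congrArg Subtype.val h)
  refine ⟨d, proper, fun p₀ p₁ p₂ p₃ p₄ h₁ h₂ h₃ h₄ n₀₂ n₁₃ n₂₄ h₁₃ h₂₄ => ?_⟩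
  refine hc.not_alternating h₁ h₂ h₃ h₄ n₀₂ ?_ n₁₃ ?_ n₂₄ (d_inj h₁ h₃ h₁₃) (d_inj h₂ h₄ h₂₄)
  · rintro rfl
    exact proper h₁ h₃.symm h₂.ne (h₁₃.trans (congrArg d Sym2.eq_swap))
  · rintro rfl
    exact proper h₂ h₄.symm h₃.ne (h₂₄.trans (congrArg d Sym2.eq_swap))

/-- Since an alternating walk with four edges repeats the color of each middle edge at the other
neighbor of the middle vertex, a condition on pairs of neighbors suffices. -/
theorem exists_isStarColoring_of_colored [Nonempty α] {Colored : V → V → α → Prop}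
    (symm : ∀ {x y a}, Colored x y a → Colored y x a)
    (exists_colored : ∀ {x y}, G.Adj x y → ∃ a, Colored x y a)
    (compatible : ∀ {v x y a b}, Colored v x a → Colored v y b → x ≠ y →
      a ≠ b ∧ ¬ ((∃ z, Colored x z b) ∧ ∃ z, Colored y z a)) :
    ∃ c : Sym2 V → α, IsStarColoring G c := by
  have choice : ∀ e : Sym2 V, ∃ a, ∀ x y, G.Adj x y → s(x, y) = e → Colored x y a := by
    intro e
    by_cases he : e ∈ G.edgeSet
    · obtain ⟨⟨x, y⟩⟩ := e
      obtain ⟨a, ha⟩ := exists_colored he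
      refine ⟨a, fun x' y' _ h => ?_⟩
      rcases Sym2.eq_iff.1 h with ⟨rfl, rfl⟩ | ⟨rfl, rfl⟩
      exacts [ha, symm ha]
    · exact ⟨Classical.arbitrary α, fun x y hxy h => absurd (h ▸ hxy) he⟩
  choose c hc using choice
  have colored : ∀ {x y}, G.Adj x y → Colored x y (c s(x, y)) := fun h => hc _ _ _ h rfl
  refine ⟨c, fun v x y hx hy hxy => (compatible (colored hx) (colored hy) hxy).1,
    fun p₀ p₁ p₂ p₃ p₄ h₁ h₂ h₃ h₄ _ n₁₃ _ h₁₃ h₂₄ => ?_⟩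
  refine (compatible (symm (colored h₂)) (colored h₃) n₁₃).2 ⟨⟨p₀, ?_⟩, p₄, ?_⟩
  · exact h₁₃ ▸ symm (colored h₁)
  · exact h₂₄ ▸ colored h₄

/-! ### The lower bound -/

theorem exists_third_neighbor {v x y : V} (hdeg : deg G v = 3) (hx : G.Adj v x) (hy : G.Adj v y)
    (hxy : x ≠ y) : ∃ z, z ≠ x ∧ z ≠ y ∧ G.neighborSet v = {x, y, z} := by
  have hsub : {x, y} ⊆ G.neighborSet v := Set.pair_subset hx hy
  have hone : (G.neighborSet v \ {x, y}).ncard = 1 := by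
    rw [Set.ncard_sdiff hsub, Set.ncard_pair hxy]
    exact congrArg (· - 2) hdeg
  obtain ⟨z, hz⟩ := Set.ncard_eq_one.1 hone
  have hzmem : z ∉ ({x, y} : Set V) := (hz.superset rfl).2
  refine ⟨z, fun h => hzmem (.inl h), fun h => hzmem (.inr h), ?_⟩
  rw [← Set.sdiff_union_of_subset hsub, hz]
  grind

theorem IsStarColoring.exists_missing_color {c : Sym2 V → α} (hc : IsStarColoring G c)
    (hα : Nat.card α = 4) {v : V} (hdeg : deg G v = 3) :
    ∃ m, ∀ a, a ≠ m ↔ ∃ x, G.Adj v x ∧ c s(v, x) = a := by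
  have : Finite α := Nat.finite_of_card_ne_zero (by omega)
  have hinj : Set.InjOn (fun x => c s(v, x)) (G.neighborSet v) := fun x hx y hy h =>
    not_imp_comm.1 (hc.proper hx hy) (not_not_intro h)
  have hone : ((fun x => c s(v, x)) '' G.neighborSet v)ᶜ.ncard = 1 := by
    rw [Set.ncard_compl, hinj.ncard_image, hα]
    exact congrArg (4 - ·) hdeg
  obtain ⟨m, hm⟩ := Set.ncard_eq_one.1 hone
  exact ⟨m, fun a => (not_congr (Set.ext_iff.1 hm a).symm).trans not_not⟩

theorem IsStarColoring.missing_color_eq {c : Sym2 V → α} (hc : IsStarColoring G c) {m : V → α}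
    (hm : ∀ v a, a ≠ m v ↔ ∃ x, G.Adj v x ∧ c s(v, x) = a) {v x y : V} (hx : G.Adj v x)
    (hy : G.Adj v y) (hxy : x ≠ y) : c s(v, y) = m x ∨ c s(v, x) = m y := by
  by_contra! h
  obtain ⟨p, hp, hpx⟩ := (hm x _).1 h.1
  obtain ⟨q, hq, hqy⟩ := (hm y _).1 h.2
  rw [Sym2.eq_swap] at hpx
  refine hc.not_alternating hp.symm hx.symm hy hq ?_ hxy ?_ hpx (by rw [Sym2.eq_swap, hqy])
  · rintro rfl
    exact hc.proper hx hy hxy hpx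
  · rintro rfl
    exact hc.proper hy hx hxy.symm (by rw [← hqy, Sym2.eq_swap])

theorem IsStarColoring.missing_color_eq_iff {c : Sym2 V → α} (hc : IsStarColoring G c) {m : V → α}
    (hm : ∀ v a, a ≠ m v ↔ ∃ x, G.Adj v x ∧ c s(v, x) = a) {v x y : V} (hdeg : deg G v = 3)
    (hx : G.Adj v x) (hy : G.Adj v y) (hxy : x ≠ y) :
    m x = c s(v, y) ↔ m y ≠ c s(v, x) := by
  obtain ⟨z, hzx, hzy, hN⟩ := exists_third_neighbor hdeg hx hy hxy
  have hz : G.Adj v z := hN.superset (by simp)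
  have := hc.missing_color_eq hm hx hy hxy
  have := hc.missing_color_eq hm hx hz hzx.symm
  have := hc.missing_color_eq hm hy hz hzy.symm
  have := hc.proper hx hy hxy
  have := hc.proper hx hz hzx.symm
  have := hc.proper hy hz hzy.symm
  grind

theorem not_isStarColoring_of_triangle (hα : Nat.card α = 4) (hdeg : ∀ v, deg G v = 3) {u v w : V}
    (huv : G.Adj u v) (hvw : G.Adj v w) (hwu : G.Adj w u) (c : Sym2 V → α) :
    ¬ IsStarColoring G c := by
  intro hc
  choose m hm using fun v => hc.exists_missing_color hα (hdeg v)
  have hne : ∀ {x y}, G.Adj x y → c s(x, y) ≠ m x := fun h => (hm _ _).2 ⟨_, h, rfl⟩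
  have hu := hc.missing_color_eq_iff hm (hdeg u) huv hwu.symm hvw.ne
  have hv := hc.missing_color_eq_iff hm (hdeg v) hvw huv.symm hwu.ne
  have hw := hc.missing_color_eq_iff hm (hdeg w) hwu hvw.symm huv.ne
  have := hc.proper huv hwu.symm hvw.ne
  have := hc.proper hvw huv.symm hwu.ne
  have := hc.proper hwu hvw.symm huv.ne
  have := hne huv; have := hne huv.symm
  have := hne hvw; have := hne hvw.symm
  have := hne hwu; have := hne hwu.symm
  grind

theorem five_le_of_starEdgeColorable_of_triangle (hdeg : ∀ v, deg G v = 3) {u v w : V}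
    (huv : G.Adj u v) (hvw : G.Adj v w) (hwu : G.Adj w u) {k : ℕ} (h : StarEdgeColorable G k) :
    5 ≤ k := by
  by_contra! hk
  obtain ⟨c, hc⟩ := h.exists_isStarColoring (Fin.castLEEmb (Nat.le_of_lt_succ hk))
  exact not_isStarColoring_of_triangle (Nat.card_fin 4) hdeg huv hvw hwu c hc

end Coloring

section Front

variable {α β : Type*}

/-! ### Fronts -/

/-- A strand cut open to the right of one of its vertices: the color of the cut edge, the colors
around its left end, and the colors which are forbidden around its right end. -/
structure Strand (α : Type*) where
  col : α
  pal : Finset α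
  forb : Finset α

/-- The three strands of a caterpillar at a cut: the spine `none` and the two rails `some b`. -/
abbrev Front (α : Type*) := Option Bool → Strand α

section DecidableEq

variable [DecidableEq α]

/-- The strand behind its next vertex, when this vertex has a rung of color `r` to a vertex with
palette `p` and the next edge of the strand gets the color `x`. -/
def Strand.next (t : Strand α) (r x : α) (p : Finset α) : Strand α :=
  ⟨x, {t.col, r, x}, ({t.col} : Finset α).filter (fun _ => x ∈ t.pal) ∪
    ({r} : Finset α).filter (fun _ => x ∈ p)⟩

/-- The colors chosen at the next vertex of the strand are admissible. -/
def Strand.Extends (t : Strand α) (r x : α) (p : Finset α) : Prop :=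
  t.col ≠ r ∧ t.col ≠ x ∧ r ≠ x ∧ (∀ a ∈ ({t.col, r, x} : Finset α), a ∉ t.forb) ∧
    ¬ (r ∈ t.pal ∧ t.col ∈ p)

instance (t : Strand α) (r x : α) (p : Finset α) : Decidable (t.Extends r x p) := by
  unfold Strand.Extends; infer_instance

namespace Front

/-- The front behind the next rung, which joins the spine to the rail `b`; the rung has color `r`,
the next edge of the rail color `x` and the next edge of the spine color `y`. -/
def advance (f : Front α) (b : Bool) (r x y : α) : Front α
  | none => (f none).next r y {(f (some b)).col, r, x}
  | some d => if d = b then (f (some b)).next r x {(f none).col, r, y} else f (some d)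

/-- The colors of the next rung and of the two edges behind it are admissible. -/
def Advances (f : Front α) (b : Bool) (r x y : α) : Prop :=
  (f none).Extends r y {(f (some b)).col, r, x} ∧ (f (some b)).Extends r x {(f none).col, r, y}

instance (f : Front α) (b : Bool) (r x y : α) : Decidable (f.Advances b r x y) := by
  unfold Advances; infer_instance

/-- The three strands may start in a common vertex. -/
def Opens (f : Front α) : Prop :=
  ∀ σ τ, (f σ).pal = (f τ).pal ∧ (f σ).col ∈ (f σ).pal ∧
    (σ ≠ τ → (f σ).col ≠ (f τ).col ∧ ((f σ).col ∈ (f τ).forb ∨ (f τ).col ∈ (f σ).forb))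

instance (f : Front α) : Decidable f.Opens := by
  unfold Opens; infer_instance

/-- The three strands may end in a common vertex. -/
def Closes (f : Front α) : Prop :=
  ∀ σ τ, (f τ).col ∉ (f σ).forb ∧ (σ ≠ τ → (f σ).col ≠ (f τ).col ∧
    ¬ ((f σ).col ∈ (f τ).pal ∧ (f τ).col ∈ (f σ).pal))

instance (f : Front α) : Decidable f.Closes := by
  unfold Closes; infer_instance

/-- The coloring can be completed when the remaining rungs are on the given sides. -/
def Completes : Front α → List Bool → Prop
  | f, [] => f.Closes
  | f, b :: l => ∃ r x y, f.Advances b r x y ∧ (f.advance b r x y).Completes l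

instance decidableCompletes [Fintype α] :
    ∀ (f : Front α) (l : List Bool), Decidable (f.Completes l)
  | f, [] => inferInstanceAs (Decidable f.Closes)
  | f, b :: l =>
    have := fun g : Front α => decidableCompletes g l
    inferInstanceAs
      (Decidable (∃ r x y, f.Advances b r x y ∧ (f.advance b r x y).Completes l))

end Front

end DecidableEq

/-! ### Comparing fronts -/

/-- The strand `t` is at least as permissive as the strand `u` with its colors renamed by `π`. -/
def Strand.Simulates (π : β → α) (t : Strand α) (u : Strand β) : Prop :=
  t.col = π u.col ∧ (∀ a, π a ∈ t.pal → a ∈ u.pal) ∧ ∀ a, π a ∈ t.forb → a ∈ u.forb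

instance [DecidableEq α] [DecidableEq β] [Fintype β] (π : β → α) (t : Strand α) (u : Strand β) :
    Decidable (t.Simulates π u) := by
  unfold Strand.Simulates; infer_instance

/-- The front `f` is at least as permissive as the front `g` with its colors renamed by `π` and, if
`e` is true, its rails exchanged. -/
def Front.Simulates (π : β → α) (e : Bool) (f : Front α) (g : Front β) : Prop :=
  ∀ σ, (f σ).Simulates π (g (σ.map (xor e)))

instance [DecidableEq α] [DecidableEq β] [Fintype β] (π : β → α) (e : Bool) (f : Front α)
    (g : Front β) : Decidable (f.Simulates π e g) := by
  unfold Front.Simulates; infer_instance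

section Simulates

variable {π : β → α}

theorem Front.Simulates.closes (hπ : Function.Injective π) {e : Bool} {f : Front α} {g : Front β}
    (h : f.Simulates π e g) (hg : g.Closes) : f.Closes := by
  intro σ τ
  obtain ⟨hσ, hσ', hσ''⟩ := h σ
  obtain ⟨hτ, hτ', -⟩ := h τ
  have hg' := hg (σ.map (xor e)) (τ.map (xor e))
  have hinj := Option.map_injective (f := xor e) fun _ _ => Bool.xor_right_inj.1
  rw [hσ, hτ, hπ.ne_iff]
  exact ⟨mt (hσ'' _) hg'.1, fun hne =>
    (hg'.2 (hinj.ne hne)).imp_right (mt (And.imp (hτ' _) (hσ' _)))⟩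

variable [DecidableEq α] [DecidableEq β]

theorem mem_triple_of_map_mem_triple (hπ : Function.Injective π) {i j k a : β}
    (h : π a ∈ ({π i, π j, π k} : Finset α)) :
    a ∈ ({i, j, k} : Finset β) := by
  simpa only [Finset.mem_insert, Finset.mem_singleton, hπ.eq_iff] using h

theorem Strand.Simulates.next (hπ : Function.Injective π) {t : Strand α} {u : Strand β}
    (h : t.Simulates π u) (r x : β) {p : Finset α} {q : Finset β} (hpq : ∀ a, π a ∈ p → a ∈ q) :
    (t.next (π r) (π x) p).Simulates π (u.next r x q) := by
  obtain ⟨hcol, hpal, -⟩ := h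
  refine ⟨rfl, fun a ha => mem_triple_of_map_mem_triple hπ (hcol ▸ ha), fun a ha => ?_⟩
  simp only [Strand.next, hcol, Finset.mem_union, Finset.mem_filter, Finset.mem_singleton,
    hπ.eq_iff] at ha ⊢
  exact ha.imp (And.imp_right (hpal x)) (And.imp_right (hpq x))

theorem Strand.Simulates.extends (hπ : Function.Injective π) {t : Strand α} {u : Strand β}
    (h : t.Simulates π u) {r x : β} {p : Finset α} {q : Finset β} (hpq : ∀ a, π a ∈ p → a ∈ q)
    (hu : u.Extends r x q) :
    t.Extends (π r) (π x) p := by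
  obtain ⟨hcol, hpal, hforb⟩ := h
  obtain ⟨h₁, h₂, h₃, h₄, h₅⟩ := hu
  refine ⟨hcol ▸ hπ.ne h₁, hcol ▸ hπ.ne h₂, hπ.ne h₃, ?_, ?_⟩
  · simp only [hcol, Finset.mem_insert, Finset.mem_singleton, forall_eq_or_imp, forall_eq] at h₄ ⊢
    exact ⟨mt (hforb _) h₄.1, mt (hforb _) h₄.2.1, mt (hforb _) h₄.2.2⟩
  · rw [hcol]
    exact mt (And.imp (hpal _) (hpq _)) h₅

namespace Front.Simulates

variable {e : Bool} {f : Front α} {g : Front β}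

theorem advance (hπ : Function.Injective π) (h : f.Simulates π e g) (b : Bool) (r x y : β) :
    (f.advance b (π r) (π x) (π y)).Simulates π e (g.advance (xor e b) r x y) := by
  have hn : (f none).Simulates π (g none) := h none
  have hb : (f (some b)).Simulates π (g (some (xor e b))) := h (some b)
  rintro (_ | d)
  · exact hn.next hπ r y fun a ha => mem_triple_of_map_mem_triple hπ (hb.1 ▸ ha)
  · by_cases hd : d = b
    · subst hd
      simpa only [Front.advance, Option.map_some, if_true] using
        hb.next hπ r x fun a ha => mem_triple_of_map_mem_triple hπ (hn.1 ▸ ha)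
    · simpa only [Front.advance, Option.map_some, hd, Bool.xor_right_inj, if_false] using h (some d)

theorem advances (hπ : Function.Injective π) (h : f.Simulates π e g) {b : Bool} {r x y : β}
    (hg : g.Advances (xor e b) r x y) : f.Advances b (π r) (π x) (π y) := by
  have hn : (f none).Simulates π (g none) := h none
  have hb : (f (some b)).Simulates π (g (some (xor e b))) := h (some b)
  exact ⟨hn.extends hπ (fun a ha => mem_triple_of_map_mem_triple hπ (hb.1 ▸ ha)) hg.1,
    hb.extends hπ (fun a ha => mem_triple_of_map_mem_triple hπ (hn.1 ▸ ha)) hg.2⟩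

theorem completes (hπ : Function.Injective π) {l : List Bool} (h : f.Simulates π e g)
    (hg : g.Completes (l.map (xor e))) : f.Completes l := by
  induction l generalizing f g with
  | nil => exact h.closes hπ hg
  | cons b l ih =>
    obtain ⟨r, x, y, hadv, hc⟩ := hg
    exact ⟨π r, π x, π y, h.advances hπ hadv, ih (h.advance hπ b r x y) hc⟩

end Front.Simulates

end Simulates

/-! ### Completing a front with five colors -/

/-- A front at the starting pole. -/
def startFront : Front (Fin 5)
  | some false => ⟨0, {0, 1, 2}, ∅⟩
  | some true => ⟨1, {0, 1, 2}, {0}⟩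
  | none => ⟨2, {0, 1, 2}, {0, 1}⟩

/-- A front, found by computer search, which recurs, up to renaming colors and exchanging the rails,
after any two rungs. The four colors of the spine palette unite the three colors which may actually
occur in the two recurrences. -/
def recurrentFront : Front (Fin 5)
  | some false => ⟨0, {0, 1, 2}, {1}⟩
  | some true => ⟨2, {1, 2, 3}, {1, 3}⟩
  | none => ⟨4, {1, 2, 3, 4}, ∅⟩

theorem exists_startFront_advance_simulates : ∀ b, ∃ (r x y : Fin 5) (π : Fin 5 → Fin 5) (e : Bool),
    π.Injective ∧ startFront.Advances b r x y ∧
      (startFront.advance b r x y).Simulates π e recurrentFront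
  | false => ⟨3, 2, 4, ![1, 0, 2, 3, 4], true, by decide +kernel⟩
  | true => ⟨3, 2, 4, ![0, 1, 2, 3, 4], false, by decide +kernel⟩

theorem exists_recurrentFront_advance_advance_simulates : ∀ b b',
    ∃ (r x y r' x' y' : Fin 5) (π : Fin 5 → Fin 5) (e : Bool),
      π.Injective ∧ recurrentFront.Advances b r x y ∧
      (recurrentFront.advance b r x y).Advances b' r' x' y' ∧
      ((recurrentFront.advance b r x y).advance b' r' x' y').Simulates π e recurrentFront
  | false, false => ⟨3, 2, 2, 1, 4, 0, ![4, 1, 2, 3, 0], false, by decide +kernel⟩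
  | false, true => ⟨3, 2, 2, 0, 4, 1, ![4, 0, 2, 3, 1], true, by decide +kernel⟩
  | true, false => ⟨0, 4, 2, 3, 2, 1, ![4, 0, 2, 3, 1], true, by decide +kernel⟩
  | true, true => ⟨0, 4, 2, 1, 2, 3, ![0, 1, 2, 4, 3], false, by decide +kernel⟩

theorem recurrentFront_completes_pair : ∀ b₁ b₂, recurrentFront.Completes [b₁, b₂] := by
  decide +kernel

theorem recurrentFront_completes_triple : ∀ b₁ b₂ b₃, recurrentFront.Completes [b₁, b₂, b₃]
  | false, false, b₃ =>
    ⟨3, 2, 0, by decide +kernel, 1, 4, 2, by decide +kernel, by revert b₃; decide +kernel⟩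
  | false, true, b₃ =>
    ⟨3, 2, 1, by decide +kernel, 0, 4, 2, by decide +kernel, by revert b₃; decide +kernel⟩
  | true, false, b₃ =>
    ⟨0, 4, 1, by decide +kernel, 2, 4, 3, by decide +kernel, by revert b₃; decide +kernel⟩
  | true, true, b₃ =>
    ⟨0, 4, 1, by decide +kernel, 3, 1, 2, by decide +kernel, by revert b₃; decide +kernel⟩

theorem recurrentFront_completes : ∀ l : List Bool, 2 ≤ l.length → recurrentFront.Completes l
  | [b₁, b₂], _ => recurrentFront_completes_pair b₁ b₂
  | [b₁, b₂, b₃], _ => recurrentFront_completes_triple b₁ b₂ b₃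
  | b₁ :: b₂ :: b₃ :: b₄ :: l, _ => by
    obtain ⟨r, x, y, r', x', y', π, e, hπ, hadv, hadv', hsim⟩ :=
      exists_recurrentFront_advance_advance_simulates b₁ b₂
    exact ⟨r, x, y, hadv, r', x', y', hadv',
      hsim.completes hπ (recurrentFront_completes _ (by simp))⟩
  termination_by l => l.length

theorem startFront_opens : startFront.Opens := by
  decide +kernel

theorem startFront_completes_singleton : ∀ b, startFront.Completes [b] := by
  decide +kernel

theorem startFront_completes : ∀ l : List Bool, l ≠ [] → l.length ≠ 2 → startFront.Completes l
  | [b], _, _ => startFront_completes_singleton b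
  | b :: b₁ :: b₂ :: l, _, _ => by
    obtain ⟨r, x, y, π, e, hπ, hadv, hsim⟩ := exists_startFront_advance_simulates b
    exact ⟨r, x, y, hadv, hsim.completes hπ (recurrentFront_completes _ (by simp))⟩

end Front

section StrandGraph

variable {n : ℕ} {α : Type*}

/-! ### The graph with three strands -/

/-- The position of a vertex along a caterpillar; `Sum.inl` enumerates the spine, extended by a leaf
at both ends (the poles), and `Sum.inr i` is the remaining leaf at the spine vertex `i + 1`. -/
def pos : Fin (n + 2) ⊕ Fin n → ℕ
  | .inl i => i
  | .inr i => i + 1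

/-- The three strands join the two poles: the spine `none`, and the rails `some b` through the
leaves on the side `b` of the spine. -/
def OnStrand (s : Fin n → Bool) (σ : Option Bool) : Fin (n + 2) ⊕ Fin n → Prop
  | .inl i => σ = none ∨ i = 0 ∨ i = Fin.last (n + 1)
  | .inr i => σ = some (s i)

instance (s : Fin n → Bool) (σ : Option Bool) : DecidablePred (OnStrand s σ)
  | .inl _ => inferInstanceAs (Decidable (_ ∨ _))
  | .inr _ => inferInstanceAs (Decidable (_ = _))

/-- The vertex `y` is the next one to the right of `x` on the strand `σ`. -/
def Consecutive (s : Fin n → Bool) (σ : Option Bool) (x y : Fin (n + 2) ⊕ Fin n) : Prop :=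
  OnStrand s σ x ∧ OnStrand s σ y ∧ pos x < pos y ∧
    ∀ z, OnStrand s σ z → pos z ≤ pos x ∨ pos y ≤ pos z

instance (s : Fin n → Bool) (σ : Option Bool) : DecidableRel (Consecutive s σ) := fun _ _ =>
  inferInstanceAs (Decidable (_ ∧ _))

/-- The cubic Halin graph of a caterpillar with `n` spine vertices whose leaf at the spine vertex
`i + 1` lies on the side `s i`: two vertices are joined if they are consecutive on a strand, or form
a rung, that is, share their position. -/
def strandGraph (s : Fin n → Bool) : SimpleGraph (Fin (n + 2) ⊕ Fin n) where
  Adj x y := (x ≠ y ∧ pos x = pos y) ∨ ∃ σ, Consecutive s σ x y ∨ Consecutive s σ y x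
  symm := ⟨fun _ _ => Or.imp (And.imp Ne.symm Eq.symm) (Exists.imp fun _ => Or.symm)⟩
  loopless := ⟨fun _ h => h.elim (fun h => h.1 rfl)
    fun ⟨_, h⟩ => h.elim (fun h => h.2.2.1.ne rfl) fun h => h.2.2.1.ne rfl⟩

instance (s : Fin n → Bool) : DecidableRel (strandGraph s).Adj := fun _ _ =>
  inferInstanceAs (Decidable (_ ∨ _))

section Strands

variable {s : Fin n → Bool} {σ τ : Option Bool} {x y z : Fin (n + 2) ⊕ Fin n}

theorem exists_onStrand (s : Fin n → Bool) : ∀ x, ∃ σ, OnStrand s σ x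
  | .inl _ => ⟨none, .inl rfl⟩
  | .inr i => ⟨some (s i), rfl⟩

theorem pos_le : ∀ x : Fin (n + 2) ⊕ Fin n, pos x ≤ n + 1
  | .inl i => Nat.le_of_lt_succ i.isLt
  | .inr i => by simp only [pos]; omega

theorem exists_onStrand_pos_eq (i : Fin n) (hx : pos x = i + 1) :
    ∃ y σ, OnStrand s σ y ∧ x ≠ y ∧ pos y = i + 1 := by
  match x with
  | .inl j => exact ⟨.inr i, some (s i), rfl, Sum.inl_ne_inr, rfl⟩
  | .inr j => exact ⟨.inl i.succ.castSucc, none, .inl rfl, Sum.inr_ne_inl, rfl⟩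

theorem OnStrand.eq_of_pos_eq (hx : OnStrand s σ x) (hy : OnStrand s σ y) (h : pos x = pos y) :
    x = y := by
  rcases x with i | i <;> rcases y with j | j <;>
    simp only [OnStrand, pos, Fin.ext_iff, Fin.val_zero, Fin.val_last] at hx hy h
  · exact congrArg _ (Fin.ext h)
  · grind
  · grind
  · exact congrArg _ (Fin.ext (by omega))

theorem OnStrand.strand_eq (hσ : OnStrand s σ x) (hτ : OnStrand s τ x) (h₀ : 0 < pos x)
    (hn : pos x ≤ n) : σ = τ := by
  rcases x with i | i <;>
    simp only [OnStrand, pos, Fin.ext_iff, Fin.val_zero, Fin.val_last] at hσ hτ h₀ hn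
  · grind
  · exact hσ.trans hτ.symm

theorem Consecutive.right_unique (hy : Consecutive s σ x y) (hz : Consecutive s σ x z) : y = z := by
  have := hy.2.2.2 z hz.2.1
  have := hz.2.2.2 y hy.2.1
  have := hy.2.2.1
  have := hz.2.2.1
  exact hy.2.1.eq_of_pos_eq hz.2.1 (by omega)

theorem Consecutive.left_unique (hx : Consecutive s σ x z) (hy : Consecutive s σ y z) : x = y := by
  have := hx.2.2.2 y hy.1
  have := hy.2.2.2 x hx.1
  have := hx.2.2.1
  have := hy.2.2.1
  exact hx.1.eq_of_pos_eq hy.1 (by omega)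

theorem Consecutive.pos_le (h : Consecutive s σ x y) : pos x ≤ n :=
  Nat.le_of_lt_succ (h.2.2.1.trans_le (HalinStar.pos_le y))

theorem exists_pos_eq_succ (h₀ : pos x ≠ 0) (hn : pos x ≤ n) : ∃ i : Fin n, pos x = i + 1 :=
  ⟨⟨pos x - 1, by omega⟩, by simp only; omega⟩

theorem exists_pos_eq_succ_of_ne (hne : x ≠ y) (h : pos x = pos y) :
    ∃ i : Fin n, pos x = i + 1 ∧ pos y = i + 1 := by
  match x, y with
  | .inl i, .inl j => exact absurd (congrArg _ (Fin.ext h)) hne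
  | .inr i, _ => exact ⟨i, rfl, h.symm⟩
  | _, .inr j => exact ⟨j, h, rfl⟩

theorem eq_of_pos_eq_of_ne (hx : x ≠ z) (hy : y ≠ z) (hxz : pos x = pos z) (hyz : pos y = pos z) :
    x = y := by
  rcases x with i | i <;> rcases y with j | j <;> rcases z with k | k <;>
    simp only [pos, ne_eq, Sum.inl.injEq, Sum.inr.injEq, Fin.ext_iff, reduceCtorEq] at * <;> omega

end Strands

/-! ### Colorings from runs of fronts -/

/-- The fronts `F` arise from each other by advancing over the rungs, which get the colors `r`. -/
structure IsRun [DecidableEq α] (s : Fin n → Bool) (F : ℕ → Front α) (r : Fin n → α) : Prop where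
  opens : (F 0).Opens
  closes : (F n).Closes
  step : ∀ i : Fin n, ∃ x y, (F i).Advances (s i) (r i) x y ∧
    F (i + 1) = (F i).advance (s i) (r i) x y

theorem exists_isRun [DecidableEq α] {f : Front α} {s : Fin n → Bool} (ho : f.Opens)
    (hc : f.Completes (List.ofFn s)) :
    ∃ (F : ℕ → Front α) (r : Fin n → α), IsRun s F r := by
  suffices ∃ (F : ℕ → Front α) (r : Fin n → α), F 0 = f ∧ (F n).Closes ∧
      ∀ i : Fin n, ∃ x y, (F i).Advances (s i) (r i) x y ∧
        F (i + 1) = (F i).advance (s i) (r i) x y by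
    obtain ⟨F, r, rfl, hcl, hstep⟩ := this
    exact ⟨F, r, ho, hcl, hstep⟩
  clear ho
  induction n generalizing f with
  | zero =>
    exact ⟨fun _ => f, Fin.elim0, rfl, by simpa [Front.Completes] using hc, fun i => i.elim0⟩
  | succ n ih =>
    rw [List.ofFn_succ] at hc
    obtain ⟨r, x, y, hadv, hc⟩ := hc
    obtain ⟨F, r', hF, hcl, hstep⟩ := ih hc
    refine ⟨fun i => Nat.casesOn i f F, Fin.cons r r', rfl, hcl, Fin.cases ?_ fun i => ?_⟩
    · exact ⟨x, y, hadv, hF⟩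
    · exact hstep i

/-- The coloring of `strandGraph s` described by a run: an edge of a strand has the color at which
the front behind its left end cuts it. -/
inductive Colored (s : Fin n → Bool) (F : ℕ → Front α) (r : Fin n → α) :
    Fin (n + 2) ⊕ Fin n → Fin (n + 2) ⊕ Fin n → α → Prop
  | right {σ x y} : Consecutive s σ x y → Colored s F r x y (F (pos x) σ).col
  | left {σ x y} : Consecutive s σ x y → Colored s F r y x (F (pos x) σ).col
  | rung {i x y} : x ≠ y → pos x = i.val + 1 → pos y = i.val + 1 → Colored s F r x y (r i)

section Runs

variable {s : Fin n → Bool} {F : ℕ → Front α} {r : Fin n → α} {σ τ : Option Bool}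
  {v x y z : Fin (n + 2) ⊕ Fin n} {i : Fin n} {a b : α}

theorem Colored.symm : Colored s F r x y a → Colored s F r y x a
  | .right h => .left h
  | .left h => .right h
  | .rung hne hx hy => .rung hne.symm hy hx

theorem exists_colored (h : (strandGraph s).Adj x y) : ∃ a, Colored s F r x y a := by
  rcases h with ⟨hne, hpos⟩ | ⟨σ, h | h⟩
  · obtain ⟨i, hx, hy⟩ := exists_pos_eq_succ_of_ne hne hpos
    exact ⟨_, .rung hne hx hy⟩
  · exact ⟨_, .right h⟩
  · exact ⟨_, .left h⟩

/-- Edges of colors `a` and `b` from a common vertex to `x` and `y` differ in color and do not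
extend to an alternating walk. -/
def Compatible (s : Fin n → Bool) (F : ℕ → Front α) (r : Fin n → α) (x y : Fin (n + 2) ⊕ Fin n)
    (a b : α) : Prop :=
  a ≠ b ∧ ¬ ((∃ z, Colored s F r x z b) ∧ ∃ z, Colored s F r y z a)

theorem Compatible.symm (h : Compatible s F r x y a b) : Compatible s F r y x b a :=
  ⟨h.1.symm, fun h' => h.2 h'.symm⟩

variable [DecidableEq α]

namespace IsRun

theorem step_of_onStrand (h : IsRun s F r) (hx : OnStrand s σ x) (hy : OnStrand s τ y) (hne : x ≠ y)
    (hxi : pos x = i + 1) (hyi : pos y = i + 1) :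
    (F i σ).Extends (r i) (F (i + 1) σ).col (F (i + 1) τ).pal ∧
      F (i + 1) σ = (F i σ).next (r i) (F (i + 1) σ).col (F (i + 1) τ).pal := by
  obtain ⟨c, d, hadv, hF⟩ := h.step i
  have spine : ∀ {j : Fin (n + 2)} {ρ}, OnStrand s ρ (.inl j) → (j : ℕ) = i + 1 → ρ = none :=
    fun hρ hj => hρ.strand_eq (τ := none) (.inl rfl) (by simp [pos, hj]) (by simp [pos, hj])
  have rail : ∀ {j : Fin n} {ρ}, OnStrand s ρ (.inr j) → pos (.inr j) = i.val + 1 →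
      ρ = some (s i) :=
    fun hρ hj => hρ.trans (by rw [Fin.ext (Nat.succ.inj hj)])
  match x, y with
  | .inl _, .inl _ => exact absurd (congrArg _ (Fin.ext (hxi.trans hyi.symm))) hne
  | .inl _, .inr _ =>
    rw [spine hx hxi, rail hy hyi, hF]
    simpa [Front.advance, Strand.next] using hadv.1
  | .inr _, .inl _ =>
    rw [rail hx hxi, spine hy hyi, hF]
    simpa [Front.advance, Strand.next] using hadv.2
  | .inr _, .inr _ =>
    exact absurd (congrArg _ (Fin.ext (Nat.succ.inj (hxi.trans hyi.symm)))) hne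

theorem exists_step (h : IsRun s F r) (hx : OnStrand s σ x) (hi : pos x = i + 1) :
    ∃ p, (F i σ).Extends (r i) (F (i + 1) σ).col p ∧
      F (i + 1) σ = (F i σ).next (r i) (F (i + 1) σ).col p := by
  obtain ⟨y, τ, hy, hne, hyi⟩ := exists_onStrand_pos_eq i hi
  exact ⟨_, h.step_of_onStrand hx hy hne hi hyi⟩

theorem succ_eq_self (h : IsRun s F r) (i : Fin n) (hσ : ∀ x, OnStrand s σ x → pos x ≠ i + 1) :
    F (i + 1) σ = F i σ := by
  obtain ⟨c, d, -, hF⟩ := h.step i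
  rcases σ with _ | b
  · exact absurd rfl (hσ (.inl i.succ.castSucc) (.inl rfl))
  · have hb : b ≠ s i := by
      rintro rfl
      exact hσ (.inr i) rfl rfl
    rw [hF]
    exact if_neg hb

theorem eq_of_consecutive (h : IsRun s F r) (hxy : Consecutive s σ x y) {j : ℕ} (hj : pos x ≤ j)
    (hjy : j < pos y) : F j σ = F (pos x) σ := by
  induction j, hj using Nat.le_induction with
  | base => rfl
  | succ j hxj ih =>
    have hjn : j < n := by have := HalinStar.pos_le y; omega
    refine (h.succ_eq_self ⟨j, hjn⟩ fun z hz hzj => ?_).trans (ih (by omega))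
    have := hxy.2.2.2 z hz
    simp only at hzj
    omega

theorem mem_triple_of_colored (h : IsRun s F r) (hx : OnStrand s σ x) (hi : pos x = i + 1)
    (ha : Colored s F r x y a) : a ∈ ({(F i σ).col, r i, (F (i + 1) σ).col} : Finset α) := by
  have strand_eq : ∀ {τ}, OnStrand s τ x → τ = σ := fun hτ =>
    hτ.strand_eq hx (by omega) (by omega)
  cases ha with
  | right hxy => simp [strand_eq hxy.1, hi]
  | left hyx =>
    have := hyx.2.2.1
    rw [← h.eq_of_consecutive (j := i) hyx (by omega) (by omega), strand_eq hyx.2.1]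
    simp
  | rung _ hxj _ => simp [Fin.ext (Nat.succ.inj (hxj.symm.trans hi))]

theorem mem_pal_of_colored (h : IsRun s F r) (hx : OnStrand s σ x) (hn : pos x ≤ n)
    (ha : Colored s F r x y a) : a ∈ (F (pos x) σ).pal := by
  by_cases h₀ : pos x = 0
  · cases ha with
    | right hxy =>
      rw [h₀, (h.opens σ _).1]
      exact (h.opens _ σ).2.1
    | left hyx => exact absurd hyx.2.2.1 (by omega)
    | rung _ hxi _ => omega
  · obtain ⟨i, hi⟩ := exists_pos_eq_succ h₀ hn
    obtain ⟨p, -, hp⟩ := h.exists_step hx hi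
    rw [hi, hp]
    exact h.mem_triple_of_colored hx hi ha

theorem notMem_forb_of_colored (h : IsRun s F r) (hxy : Consecutive s σ x y)
    (ha : Colored s F r y z a) : a ∉ (F (pos x) σ).forb := by
  have hlt := hxy.2.2.1
  have hn := hxy.pos_le
  by_cases hy : pos y ≤ n
  · obtain ⟨i, hi⟩ := exists_pos_eq_succ (by omega) hy
    obtain ⟨p, hext, -⟩ := h.exists_step hxy.2.1 hi
    rw [← h.eq_of_consecutive hxy (j := i) (by omega) (by omega)]
    exact hext.2.2.2.1 a (h.mem_triple_of_colored hxy.2.1 hi ha)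
  · rw [← h.eq_of_consecutive hxy hn (by omega)]
    cases ha with
    | right hyz => exact absurd hyz.pos_le hy
    | left hzy =>
      rw [← h.eq_of_consecutive hzy hzy.pos_le (by omega)]
      exact (h.closes σ _).1
    | rung _ hyi _ => omega

theorem compatible_right_right (h : IsRun s F r) (hx : Consecutive s σ v x)
    (hy : Consecutive s τ v y) (hxy : x ≠ y) :
    Compatible s F r x y (F (pos v) σ).col (F (pos v) τ).col := by
  have hστ : σ ≠ τ := by
    rintro rfl
    exact hxy (hx.right_unique hy)
  have hv : pos v = 0 := by
    by_contra h₀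
    exact hστ (hx.1.strand_eq hy.1 (by omega) hx.pos_le)
  obtain ⟨hne, hforb⟩ := hv ▸ (h.opens σ τ).2.2 hστ
  refine ⟨hne, fun ⟨⟨z, hz⟩, w, hw⟩ => ?_⟩
  exact hforb.elim (h.notMem_forb_of_colored hy hw) (h.notMem_forb_of_colored hx hz)

theorem compatible_left_left (h : IsRun s F r) (hx : Consecutive s σ x v)
    (hy : Consecutive s τ y v) (hxy : x ≠ y) :
    Compatible s F r x y (F (pos x) σ).col (F (pos y) τ).col := by
  have hστ : σ ≠ τ := by
    rintro rfl
    exact hxy (hx.left_unique hy)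
  have hlt := hx.2.2.1
  have hv : n < pos v := by
    by_contra! hn
    exact hστ (hx.2.1.strand_eq hy.2.1 (by omega) hn)
  have hFx := h.eq_of_consecutive hx hx.pos_le hv
  have hFy := h.eq_of_consecutive hy hy.pos_le hv
  obtain ⟨hne, hpal⟩ := (h.closes σ τ).2 hστ
  rw [hFx, hFy] at hne hpal
  exact ⟨hne, fun ⟨⟨_, hz⟩, _, hw⟩ =>
    hpal ⟨h.mem_pal_of_colored hy.1 hy.pos_le hw, h.mem_pal_of_colored hx.1 hx.pos_le hz⟩⟩

theorem compatible_left_right (h : IsRun s F r) (hx : Consecutive s σ x v)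
    (hy : Consecutive s τ v y) : Compatible s F r x y (F (pos x) σ).col (F (pos v) τ).col := by
  have hlt := hx.2.2.1
  obtain ⟨i, hi⟩ := exists_pos_eq_succ (x := v) (by omega) hy.pos_le
  obtain rfl := hx.2.1.strand_eq hy.1 (by omega) hy.pos_le
  obtain ⟨p, hext, hnext⟩ := h.exists_step hy.1 hi
  have hFx := h.eq_of_consecutive (j := i) hx (by omega) (by omega)
  refine ⟨by rw [← hFx, hi]; exact hext.2.1, fun ⟨⟨_, hz⟩, _, hw⟩ => ?_⟩
  have hpal := h.mem_pal_of_colored hx.1 hx.pos_le hz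
  have hforb := h.notMem_forb_of_colored hy hw
  rw [hi, ← hFx] at hpal hforb
  refine hforb ?_
  rw [hnext]
  exact Finset.mem_union_left _ (Finset.mem_filter.2 ⟨Finset.mem_singleton_self _, hpal⟩)

theorem compatible_left_rung (h : IsRun s F r) (hx : Consecutive s σ x v) (hne : v ≠ y)
    (hv : pos v = i + 1) (hy : pos y = i + 1) :
    Compatible s F r x y (F (pos x) σ).col (r i) := by
  obtain ⟨τ, hτ⟩ := exists_onStrand s y
  have hext := (h.step_of_onStrand hx.2.1 hτ hne hv hy).1
  have hlt := hx.2.2.1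
  have hFx := h.eq_of_consecutive (j := i) hx (by omega) (by omega)
  refine ⟨hFx ▸ hext.1, fun ⟨⟨_, hz⟩, _, hw⟩ => hext.2.2.2.2 ⟨?_, ?_⟩⟩
  · exact hFx ▸ h.mem_pal_of_colored hx.1 hx.pos_le hz
  · exact hFx ▸ hy ▸ h.mem_pal_of_colored hτ (by omega) hw

theorem compatible_right_rung (h : IsRun s F r) (hx : Consecutive s σ v x) (hne : v ≠ y)
    (hv : pos v = i + 1) (hy : pos y = i + 1) :
    Compatible s F r x y (F (pos v) σ).col (r i) := by
  obtain ⟨τ, hτ⟩ := exists_onStrand s y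
  obtain ⟨hext, hnext⟩ := h.step_of_onStrand hx.1 hτ hne hv hy
  refine ⟨hv ▸ hext.2.2.1.symm, fun ⟨⟨_, hz⟩, _, hw⟩ => h.notMem_forb_of_colored hx hz ?_⟩
  have hpal := h.mem_pal_of_colored hτ (by omega) hw
  rw [hv] at hpal ⊢
  rw [hy] at hpal
  rw [hnext]
  exact Finset.mem_union_right _ (Finset.mem_filter.2 ⟨Finset.mem_singleton_self _, hpal⟩)

theorem compatible (h : IsRun s F r) (ha : Colored s F r v x a) (hb : Colored s F r v y b)
    (hxy : x ≠ y) : Compatible s F r x y a b := by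
  cases ha with
  | right hx =>
    cases hb with
    | right hy => exact h.compatible_right_right hx hy hxy
    | left hy => exact (h.compatible_left_right hy hx).symm
    | rung hne hv hy => exact h.compatible_right_rung hx hne hv hy
  | left hx =>
    cases hb with
    | right hy => exact h.compatible_left_right hx hy
    | left hy => exact h.compatible_left_left hx hy hxy
    | rung hne hv hy => exact h.compatible_left_rung hx hne hv hy
  | rung hne hv hx =>
    cases hb with
    | right hy => exact (h.compatible_right_rung hy hne hv hx).symm
    | left hy => exact (h.compatible_left_rung hy hne hv hx).symm
    | rung hne' hv' hy =>
      exact absurd (eq_of_pos_eq_of_ne hne.symm hne'.symm (by omega) (by omega)) hxy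

end IsRun

end Runs

theorem exists_isStarColoring_strandGraph (h₀ : n ≠ 0) (h₂ : n ≠ 2) (s : Fin n → Bool) :
    ∃ c : Sym2 (Fin (n + 2) ⊕ Fin n) → Fin 5, IsStarColoring (strandGraph s) c := by
  obtain ⟨F, r, h⟩ := exists_isRun startFront_opens
    (startFront_completes (List.ofFn s) (by simpa using h₀) (by simpa using h₂))
  exact exists_isStarColoring_of_colored (Colored := Colored s F r) Colored.symm exists_colored
    h.compatible

theorem exists_triangle_strandGraph (h₀ : n ≠ 0) (s : Fin n → Bool) :
    ∃ x y z, (strandGraph s).Adj x y ∧ (strandGraph s).Adj y z ∧ (strandGraph s).Adj z x := by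
  have h₁ : pos (n := n) (.inl 1) = 1 := by simp [pos]
  refine ⟨.inl 0, .inl 1, .inr ⟨0, Nat.pos_of_ne_zero h₀⟩,
    .inr ⟨none, .inl ⟨.inl rfl, .inl rfl, ?_, fun z _ => ?_⟩⟩, .inl ⟨Sum.inl_ne_inr, h₁⟩,
    .inr ⟨some (s _), .inr ⟨.inr (.inl rfl), rfl, Nat.one_pos, fun z _ => ?_⟩⟩⟩
  · exact Nat.one_pos.trans_eq h₁.symm
  · exact (Nat.eq_zero_or_pos (pos z)).imp Nat.le_of_eq h₁.trans_le
  · exact (Nat.eq_zero_or_pos (pos z)).imp_left Nat.le_of_eq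

/-- The isomorphism with the prism `necklace 2`; it takes the triangle at the left pole to the
triangle of `v₁`, `u₀` and `u₁`. -/
def prismMap (s : Fin 2 → Bool) : Fin 4 ⊕ Fin 2 → Fin 2 ⊕ Fin 4
  | .inl 0 => .inr 0
  | .inl 1 => .inl 0
  | .inl 2 => .inl 1
  | .inl 3 => .inr (if s 0 = s 1 then 3 else 2)
  | .inr 0 => .inr 1
  | .inr 1 => .inr (if s 0 = s 1 then 2 else 3)

instance : DecidableRel (necklace 2).Adj := fun x y => by
  unfold necklace
  rcases x with x | x <;> rcases y with y | y <;> simp only [SimpleGraph.fromRel_adj] <;>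
    infer_instance

theorem nonempty_strandGraph_iso_prism (s : Fin 2 → Bool) :
    Nonempty (strandGraph s ≃g necklace 2) := by
  have bijective : (prismMap s).Bijective := by revert s; decide +kernel
  have adj_iff : ∀ x y,
      (necklace 2).Adj (prismMap s x) (prismMap s y) ↔ (strandGraph s).Adj x y := by
    revert s; decide +kernel
  exact ⟨⟨Equiv.ofBijective _ bijective, fun {x y} => adj_iff x y⟩⟩

end StrandGraph

section RotationSystem

variable {V : Type*} {G T : SimpleGraph V} {r : V} {C : G.Walk r r}

/-! ### Rotation systems -/

namespace RotationSystem

variable {R : RotationSystem G} {u x y z t a b c : V} {d : Bool}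

/-- In the cyclic order around `u` the neighbor `x` is followed by `y`. -/
def Turn (R : RotationSystem G) (u x y : V) : Prop :=
  ∃ (hx : G.Adj u x) (hy : G.Adj u y), R.rot ⟨(u, x), hx⟩ = ⟨(u, y), hy⟩

/-- The darts `(x, y)` and `(z, t)` belong to the same facial walk. -/
def SameFace (R : RotationSystem G) (x y z t : V) : Prop :=
  ∃ (hxy : G.Adj x y) (hzt : G.Adj z t), R.faceMap.SameCycle ⟨(x, y), hxy⟩ ⟨(z, t), hzt⟩

theorem SameFace.refl (h : G.Adj x y) : R.SameFace x y x y := ⟨h, h, .rfl⟩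

theorem SameFace.symm : R.SameFace x y z t → R.SameFace z t x y :=
  fun ⟨h, h', hs⟩ => ⟨h', h, hs.symm⟩

theorem SameFace.trans : R.SameFace x y z t → R.SameFace z t a b → R.SameFace x y a b :=
  fun ⟨h, _, hs⟩ ⟨_, h', hs'⟩ => ⟨h, h', hs.trans hs'⟩

theorem Turn.sameFace : R.Turn u x y → R.SameFace x u u y := fun ⟨h, h', hr⟩ =>
  ⟨h.symm, h', hr ▸ Equiv.Perm.sameCycle_apply_right.2 .rfl⟩

theorem exists_turn (R : RotationSystem G) (h : G.Adj u x) : ∃ y, R.Turn u x y := by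
  have hf := R.rot_fst ⟨(u, x), h⟩
  generalize hd : R.rot ⟨(u, x), h⟩ = d at hf
  obtain ⟨⟨u, y⟩, hy⟩ := d
  obtain rfl := hf
  exact ⟨y, h, hy, hd⟩

theorem Turn.right_unique : R.Turn u x y → R.Turn u x z → y = z :=
  fun ⟨_, _, h⟩ ⟨_, _, h'⟩ => congrArg (fun d : G.Dart => d.snd) (h.symm.trans h')

theorem Turn.eq_or_eq_of_turn (h : R.Turn u x y) (h' : R.Turn u y x) (hz : G.Adj u z) :
    z = x ∨ z = y := by
  obtain ⟨hx, _, h⟩ := h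
  obtain ⟨_, _, h'⟩ := h'
  obtain ⟨i, hi⟩ := R.cyclic ⟨(u, x), hx⟩ ⟨(u, z), hz⟩ rfl
  rcases Equiv.Perm.zpow_apply_eq_of_apply_apply_eq_self (h ▸ h') i with h₀ | h₁
  · exact .inl (congrArg (fun d : G.Dart => d.snd) (hi.symm.trans h₀))
  · exact .inr (congrArg (fun d : G.Dart => d.snd) (hi.symm.trans (h₁.trans h)))

theorem Turn.cyclic (hab : a ≠ b) (hac : a ≠ c) (hbc : b ≠ c) (hu : G.neighborSet u = {a, b, c})
    (h : R.Turn u a b) : R.Turn u b c ∧ R.Turn u c a := by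
  have hadj : ∀ {x}, G.Adj u x ↔ x = a ∨ x = b ∨ x = c := fun {x} => Set.ext_iff.1 hu x
  have ha : G.Adj u a := hadj.2 (.inl rfl)
  have hc : G.Adj u c := hadj.2 (.inr (.inr rfl))
  obtain ⟨y, hy⟩ := R.exists_turn (hadj.2 (.inr (.inl rfl)))
  have hy' : R.Turn u b c := by
    rcases hadj.1 hy.2.1 with rfl | rfl | rfl
    · exact absurd (h.eq_or_eq_of_turn hy hc) (by tauto)
    · exact absurd (hy.eq_or_eq_of_turn hy ha) (by tauto)
    · exact hy
  refine ⟨hy', ?_⟩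
  obtain ⟨z, hz⟩ := R.exists_turn hc
  rcases hadj.1 hz.2.1 with rfl | rfl | rfl
  · exact hz
  · exact absurd (hy'.eq_or_eq_of_turn hz ha) (by tauto)
  · exact absurd (hz.eq_or_eq_of_turn hz ha) (by tauto)

theorem turn_or_turn (R : RotationSystem G) (hab : a ≠ b) (hu : G.neighborSet u = {a, b, c}) :
    R.Turn u a b ∨ R.Turn u a c := by
  have hadj : ∀ {x}, G.Adj u x ↔ x = a ∨ x = b ∨ x = c := fun {x} => Set.ext_iff.1 hu x
  obtain ⟨y, hy⟩ := R.exists_turn (hadj.2 (.inl rfl))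
  rcases hadj.1 hy.2.1 with rfl | rfl | rfl
  · exact absurd (hy.eq_or_eq_of_turn hy (hadj.2 (.inr (.inl rfl)))) (by tauto)
  · exact .inl hy
  · exact .inr hy

/-- The darts `(x, y)` and `(z, t)`, both reversed if `d` is false, belong to the same facial
walk. This allows to follow facial walks in both directions at once. -/
def SameFaceAlong (R : RotationSystem G) : Bool → V → V → V → V → Prop
  | true, x, y, z, t => R.SameFace x y z t
  | false, x, y, z, t => R.SameFace y x t z

theorem SameFaceAlong.refl (h : G.Adj x y) : R.SameFaceAlong d x y x y :=
  match d with
  | true => SameFace.refl h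
  | false => SameFace.refl h.symm

theorem SameFaceAlong.trans (h : R.SameFaceAlong d x y z t) (h' : R.SameFaceAlong d z t a b) :
    R.SameFaceAlong d x y a b :=
  match d with
  | true => SameFace.trans h h'
  | false => SameFace.trans h h'

end RotationSystem

/-! ### The rim of a Halin graph -/

theorem eq_of_deg_eq_one {x y z : V} (hx : deg T x = 1) (hy : T.Adj x y) (hz : T.Adj x z) :
    y = z := by
  obtain ⟨c, hc⟩ := Set.ncard_eq_one.1 hx
  exact (hc.subset hy).trans (hc.subset hz).symm

theorem exists_adj_of_deg_eq_one {x : V} (hx : deg T x = 1) : ∃ y, T.Adj x y :=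
  let ⟨c, hc⟩ := Set.ncard_eq_one.1 hx
  ⟨c, hc.superset rfl⟩

/-- The cycle `C` traverses an edge from `x` to `y`, in this direction. -/
def RimStep (C : G.Walk r r) (x y : V) : Prop :=
  ∃ h : G.Adj x y, (⟨(x, y), h⟩ : G.Dart) ∈ C.darts

theorem mem_edges_iff {x y : V} : s(x, y) ∈ C.edges ↔ RimStep C x y ∨ RimStep C y x := by
  unfold SimpleGraph.Walk.edges
  rw [List.mem_map]
  constructor
  · rintro ⟨⟨⟨a, b⟩, hab⟩, hd, he⟩
    rcases Sym2.eq_iff.1 he with ⟨rfl, rfl⟩ | ⟨rfl, rfl⟩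
    exacts [.inl ⟨hab, hd⟩, .inr ⟨hab, hd⟩]
  · rintro (⟨h, hd⟩ | ⟨h, hd⟩)
    exacts [⟨_, hd, rfl⟩, ⟨_, hd, Sym2.eq_swap⟩]

namespace IsHalin

variable {x y z t : V}

theorem not_adj_of_leaf (H : IsHalin G T C) (hx : deg T x = 1) (hy : deg T y = 1) :
    ¬ T.Adj x y := by
  classical
  intro hxy
  have all : ∀ v, v = x ∨ v = y := fun v => by
    induction (SimpleGraph.reachable_iff_reflTransGen x v).1
      (H.isTree.connected.preconnected x v) with
    | refl => exact .inl rfl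
    | tail _ h ih =>
      rcases ih with rfl | rfl
      · exact .inr (eq_of_deg_eq_one hx h hxy)
      · exact .inl (eq_of_deg_eq_one hy h hxy.symm)
  have hsub : C.support.tail.toFinset ⊆ {x, y} := fun v _ => by simpa using all v
  have hcard := (Finset.card_le_card hsub).trans Finset.card_le_two
  rw [List.toFinset_card_of_nodup H.isCycle.support_nodup, List.length_tail,
    SimpleGraph.Walk.length_support] at hcard
  have := H.isCycle.three_le_length
  omega

theorem deg_eq_one_of_rimStep (H : IsHalin G T C) (h : RimStep C x y) :
    deg T x = 1 ∧ deg T y = 1 :=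
  let ⟨_, hd⟩ := h
  ⟨(H.mem_cycle x).1 (C.dart_fst_mem_support_of_mem_darts hd),
    (H.mem_cycle y).1 (C.dart_snd_mem_support_of_mem_darts hd)⟩

theorem mem_tail_support (H : IsHalin G T C) (h : deg T x = 1) : x ∈ C.support.tail := by
  rcases C.mem_support_iff.1 ((H.mem_cycle x).2 h) with rfl | h'
  · exact SimpleGraph.Walk.end_mem_tail_support H.isCycle.not_nil
  · exact h'

theorem exists_rimStep_right (H : IsHalin G T C) (h : deg T x = 1) : ∃ y, RimStep C x y := by
  have hx := C.tail_support_perm_dropLast_support.mem_iff.1 (H.mem_tail_support h)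
  rw [← SimpleGraph.Walk.map_fst_darts, List.mem_map] at hx
  obtain ⟨⟨⟨_, y⟩, hxy⟩, hd, rfl⟩ := hx
  exact ⟨y, hxy, hd⟩

theorem exists_rimStep_left (H : IsHalin G T C) (h : deg T x = 1) : ∃ y, RimStep C y x := by
  have hx := H.mem_tail_support h
  rw [← SimpleGraph.Walk.map_snd_darts, List.mem_map] at hx
  obtain ⟨⟨⟨y, _⟩, hyx⟩, hd, rfl⟩ := hx
  exact ⟨y, hyx, hd⟩

theorem rimStep_right_unique (H : IsHalin G T C) (h : RimStep C x y) (h' : RimStep C x z) :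
    y = z := by
  have hn := H.isCycle.nodup_dropLast_support
  rw [← SimpleGraph.Walk.map_fst_darts] at hn
  exact congrArg (fun d : G.Dart => d.snd) (List.inj_on_of_nodup_map hn h.2 h'.2 rfl)

theorem rimStep_left_unique (H : IsHalin G T C) (h : RimStep C y x) (h' : RimStep C z x) :
    y = z := by
  have hn := H.isCycle.support_nodup
  rw [← SimpleGraph.Walk.map_snd_darts] at hn
  exact congrArg (fun d : G.Dart => d.fst) (List.inj_on_of_nodup_map hn h.2 h'.2 rfl)

theorem rimStep_asymm (H : IsHalin G T C) (h : RimStep C x y) : ¬ RimStep C y x := fun h' =>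
  h.1.ne (congrArg (fun d : G.Dart => d.fst)
    (List.inj_on_of_nodup_map H.isCycle.edges_nodup h.2 h'.2 Sym2.eq_swap))

theorem adj_iff (H : IsHalin G T C) : G.Adj x y ↔ T.Adj x y ∨ RimStep C x y ∨ RimStep C y x := by
  rw [← mem_edges_iff, ← SimpleGraph.mem_edgeSet, H.union, SimpleGraph.mem_edgeSet]

theorem not_adj_of_rimStep (H : IsHalin G T C) (h : RimStep C x y) : ¬ T.Adj x y :=
  H.not_adj_of_leaf (H.deg_eq_one_of_rimStep h).1 (H.deg_eq_one_of_rimStep h).2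

theorem neighborSet_inner (H : IsHalin G T C) (hx : deg T x ≠ 1) :
    G.neighborSet x = T.neighborSet x := by
  ext y
  refine H.adj_iff.trans (or_iff_left ?_)
  rintro (h | h)
  exacts [hx (H.deg_eq_one_of_rimStep h).1, hx (H.deg_eq_one_of_rimStep h).2]

theorem neighborSet_leaf (H : IsHalin G T C) (h : RimStep C x y) (h' : RimStep C y z)
    (ht : T.Adj y t) : x ≠ z ∧ x ≠ t ∧ z ≠ t ∧ G.neighborSet y = {x, z, t} := by
  refine ⟨?_, ?_, ?_, Set.ext fun u => H.adj_iff.trans ⟨?_, ?_⟩⟩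
  · rintro rfl
    exact H.rimStep_asymm h h'
  · rintro rfl
    exact H.not_adj_of_rimStep h ht.symm
  · rintro rfl
    exact H.not_adj_of_rimStep h' ht
  · rintro (hu | hu | hu)
    · exact .inr (.inr (eq_of_deg_eq_one (H.deg_eq_one_of_rimStep h).2 hu ht))
    · exact .inr (.inl (H.rimStep_right_unique hu h'))
    · exact .inl (H.rimStep_left_unique hu h)
  · rintro (rfl | rfl | rfl)
    exacts [.inr (.inr h), .inr (.inl h'), .inl ht]

theorem deg_leaf (H : IsHalin G T C) (hx : deg T x = 1) : deg G x = 3 := by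
  obtain ⟨y, hy⟩ := H.exists_rimStep_left hx
  obtain ⟨z, hz⟩ := H.exists_rimStep_right hx
  obtain ⟨t, ht⟩ := exists_adj_of_deg_eq_one hx
  exact Set.ncard_eq_three.2 ⟨y, z, t, H.neighborSet_leaf hy hz ht⟩

end IsHalin

theorem IsCubicHalin.deg_eq (H : IsCubicHalin G T C) (v : V) : deg G v = 3 := by
  by_cases hv : deg T v = 1
  · exact H.isHalin.deg_leaf hv
  · exact (congrArg Set.ncard (H.isHalin.neighborSet_inner hv)).trans (H.deg_eq_three v hv)

/-! ### Euler's formula -/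

namespace IsHalin

variable {R : RotationSystem G} {d₀ : G.Dart}

theorem ncard_edgeSet [Finite V] (H : IsHalin G T C) :
    G.edgeSet.ncard + 1 = Nat.card V + C.length := by
  classical
  have := Fintype.ofFinite V
  have hunion : G.edgeSet = T.edgeSet ∪ (C.edges.toFinset : Set (Sym2 V)) :=
    Set.ext fun e => (H.union e).trans (or_congr_right List.mem_toFinset.symm)
  have hdisj : Disjoint T.edgeSet (C.edges.toFinset : Set (Sym2 V)) := by
    rw [Set.disjoint_left]
    rintro ⟨x, y⟩ h hC
    rcases mem_edges_iff.1 (List.mem_toFinset.1 hC) with h' | h'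
    exacts [H.not_adj_of_rimStep h' h, H.not_adj_of_rimStep h' h.symm]
  rw [hunion, Set.ncard_union_eq hdisj (Set.toFinite _) (Set.toFinite _), Set.ncard_coe_finset,
    List.toFinset_card_of_nodup H.isCycle.edges_nodup, SimpleGraph.Walk.length_edges,
    Nat.card_eq_fintype_card, ← H.isTree.card_edgeFinset, ← SimpleGraph.coe_edgeFinset,
    Set.ncard_coe_finset]
  omega

/-- By Euler's formula there are only `C.length` faces besides the exterior one, so that each of
them meets only one reversed dart of `C` if each meets at least one. -/
theorem eq_of_sameCycle_symm [Finite V] (H : IsHalin G T C) (hR : R.IsPlane)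
    (hd₀ : ∀ d : G.Dart, d ∈ C.darts ↔ R.faceMap.SameCycle d₀ d)
    (hits : ∀ d, d ∉ C.darts → ∃ c ∈ C.darts, R.faceMap.SameCycle d c.symm)
    {c c' : G.Dart} (hc : c ∈ C.darts) (hc' : c' ∈ C.darts)
    (h : R.faceMap.SameCycle c.symm c'.symm) : c = c' := by
  classical
  have hnodup : C.darts.Nodup := List.Nodup.of_map _ H.isCycle.edges_nodup
  let face : Option {d : G.Dart // d ∈ C.darts.toFinset} → R.Face := fun o =>
    Quotient.mk (Equiv.Perm.SameCycle.setoid R.faceMap) (o.elim d₀ fun d => d.1.symm)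
  have hsurj : Function.Surjective face := by
    rintro ⟨d⟩
    by_cases hd : d ∈ C.darts
    · exact ⟨none, Quotient.sound ((hd₀ d).1 hd)⟩
    · obtain ⟨c, hc, hs⟩ := hits d hd
      exact ⟨some ⟨c, List.mem_toFinset.2 hc⟩, Quotient.sound hs.symm⟩
  have hcard : Nat.card (Option {d : G.Dart // d ∈ C.darts.toFinset}) ≤ Nat.card R.Face := by
    have euler := hR.2
    have hedges := H.ncard_edgeSet
    rw [Nat.card_eq_fintype_card, Fintype.card_option, Fintype.card_coe,
      List.toFinset_card_of_nodup hnodup, SimpleGraph.Walk.length_darts]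
    omega
  have hinj := (hsurj.bijective_of_nat_card_le hcard).1
  have := @hinj (some ⟨c, List.mem_toFinset.2 hc⟩) (some ⟨c', List.mem_toFinset.2 hc'⟩)
    (Quotient.sound h)
  exact congrArg Subtype.val (Option.some.inj this)

theorem turn_of_rimStep (H : IsHalin G T C)
    (hd₀ : ∀ d : G.Dart, d ∈ C.darts ↔ R.faceMap.SameCycle d₀ d) {x y z : V} (h : RimStep C x y)
    (h' : RimStep C y z) : R.Turn y x z := by
  obtain ⟨w, hw⟩ := R.exists_turn h.1.symm
  obtain ⟨_, hyw, hs⟩ := hw.sameFace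
  have : RimStep C y w := ⟨hyw, (hd₀ _).2 (((hd₀ _).1 h.2).trans hs)⟩
  rwa [H.rimStep_right_unique h' this]

theorem sameFace_of_rimStep_right (H : IsHalin G T C)
    (hd₀ : ∀ d : G.Dart, d ∈ C.darts ↔ R.faceMap.SameCycle d₀ d) {x y t : V} (h : RimStep C x y)
    (ht : T.Adj x t) : R.SameFace y x x t := by
  obtain ⟨w, hw⟩ := H.exists_rimStep_left (H.deg_eq_one_of_rimStep h).1
  obtain ⟨hwy, hwt, hyt, hN⟩ := H.neighborSet_leaf hw h ht
  exact ((H.turn_of_rimStep hd₀ hw h).cyclic hwy hwt hyt hN).1.sameFace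

theorem sameFace_of_rimStep_left (H : IsHalin G T C)
    (hd₀ : ∀ d : G.Dart, d ∈ C.darts ↔ R.faceMap.SameCycle d₀ d) {x y t : V} (h : RimStep C x y)
    (ht : T.Adj t y) : R.SameFace t y y x := by
  obtain ⟨z, hz⟩ := H.exists_rimStep_right (H.deg_eq_one_of_rimStep h).2
  obtain ⟨hxz, hxt, hzt, hN⟩ := H.neighborSet_leaf h hz ht.symm
  exact ((H.turn_of_rimStep hd₀ h hz).cyclic hxz hxt hzt hN).2.sameFace

/-- A facial walk which enters the tree at the leaf `x` and leaves it at the leaf `z` is closed by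
the edge of `C` from `x` to `z`. -/
theorem rimStep_of_sameFace [Finite V] (H : IsHalin G T C) (hR : R.IsPlane)
    (hd₀ : ∀ d : G.Dart, d ∈ C.darts ↔ R.faceMap.SameCycle d₀ d)
    (exits : ∀ {x y}, T.Adj x y → ∃ z t, deg T z = 1 ∧ T.Adj t z ∧ R.SameFace x y t z)
    {x t t' z : V} (hx : deg T x = 1) (hz : deg T z = 1) (hxt : T.Adj x t) (htz : T.Adj t' z)
    (hs : R.SameFace x t t' z) : RimStep C x z := by
  obtain ⟨y, hxy⟩ := H.exists_rimStep_right hx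
  obtain ⟨w, hwz⟩ := H.exists_rimStep_left hz
  obtain ⟨_, _, hface⟩ := ((H.sameFace_of_rimStep_right hd₀ hxy hxt).trans hs).trans
    (H.sameFace_of_rimStep_left hd₀ hwz htz)
  have hits : ∀ d, d ∉ C.darts → ∃ c ∈ C.darts, R.faceMap.SameCycle d c.symm := by
    rintro ⟨⟨a, b⟩, hab⟩ hd
    rcases H.adj_iff.1 hab with h | h | h
    · obtain ⟨z, t, hz, ht, hexit⟩ := exits h
      obtain ⟨p, hp⟩ := H.exists_rimStep_left hz
      obtain ⟨_, _, hs⟩ := hexit.trans (H.sameFace_of_rimStep_left hd₀ hp ht)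
      exact ⟨⟨(p, z), hp.1⟩, hp.2, hs⟩
    · exact absurd h.2 hd
    · exact ⟨⟨(b, a), h.1⟩, h.2, .rfl⟩
  have hdart := H.eq_of_sameCycle_symm hR hd₀ hits hxy.2 hwz.2 hface
  obtain rfl : y = z := congrArg (fun d : G.Dart => d.snd) hdart
  exact hxy

end IsHalin

end RotationSystem

section Comb

variable {V : Type*} {G T : SimpleGraph V} {r : V} {C : G.Walk r r} {n : ℕ} {w l : ℕ → V}

/-! ### Combs -/

/-- The vertices `w 1, …, w n` are the spine of a caterpillar, in this order, and `w 0` and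
`w (n + 1)` are leaves attached to its ends. -/
structure IsSpine (T : SimpleGraph V) (n : ℕ) (w : ℕ → V) : Prop where
  adj : ∀ i ≤ n, T.Adj (w i) (w (i + 1))
  injOn : Set.InjOn w (Set.Iic (n + 1))
  deg_zero : deg T (w 0) = 1
  deg_last : deg T (w (n + 1)) = 1
  deg_inner : ∀ i < n, deg T (w (i + 1)) ≠ 1
  cover : ∀ x, deg T x ≠ 1 → ∃ i < n, x = w (i + 1)
  succ_of_adj : ∀ i < n, ∀ j < n, T.Adj (w (i + 1)) (w (j + 1)) → j = i + 1 ∨ i = j + 1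

/-- A cubic caterpillar: a spine with one further leaf `l i` attached to each vertex `w (i + 1)`. -/
structure IsComb (T : SimpleGraph V) (n : ℕ) (w l : ℕ → V) : Prop extends IsSpine T n w where
  deg_leaf : ∀ i < n, deg T (l i) = 1
  leaf_ne : ∀ i < n, l i ≠ w i ∧ l i ≠ w (i + 2)
  neighborSet : ∀ i < n, T.neighborSet (w (i + 1)) = {w i, w (i + 2), l i}

theorem exists_adj_ne_ne {v : V} (h : deg T v = 3) (a b : V) : ∃ x, T.Adj v x ∧ x ≠ a ∧ x ≠ b := by
  have hlt : ({a, b} : Set V).ncard < (T.neighborSet v).ncard := by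
    have := Set.ncard_insert_le a {b}
    rw [Set.ncard_singleton] at this
    exact (this.trans_lt (Nat.lt_succ_self 2)).trans_eq h.symm
  obtain ⟨x, hx, hab⟩ := Set.exists_mem_notMem_of_ncard_lt_ncard hlt
  exact ⟨x, hx, not_or.1 hab⟩

/-- The vertices `p 0, …, p (n - 1)` enumerate the set `S` and induce a path, in this order. -/
structure InducesPath (T : SimpleGraph V) (S : Set V) (n : ℕ) (p : ℕ → V) : Prop where
  injOn : Set.InjOn p (Set.Iio n)
  mem_iff : ∀ x, x ∈ S ↔ ∃ k < n, x = p k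
  adj_iff : ∀ i < n, ∀ j < n, T.Adj (p i) (p j) ↔ i + 1 = j ∨ j + 1 = i

theorem exists_inducesPath [Nonempty V] {S : Set V}
    (e : T.induce S ≃g SimpleGraph.pathGraph n) : ∃ p, InducesPath T S n p := by
  classical
  let p : ℕ → V := fun k => if h : k < n then e.symm ⟨k, h⟩ else Classical.arbitrary V
  have p_eq : ∀ {k} (h : k < n), p k = e.symm ⟨k, h⟩ := fun h => dif_pos h
  refine ⟨p, fun i hi j hj h => ?_, fun x => ⟨fun hx => ?_, ?_⟩, fun i hi j hj => ?_⟩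
  · rw [p_eq hi, p_eq hj] at h
    exact congrArg Fin.val (e.symm.injective (Subtype.ext h))
  · exact ⟨e ⟨x, hx⟩, (e ⟨x, hx⟩).isLt, by rw [p_eq (e ⟨x, hx⟩).isLt, Fin.eta, e.symm_apply_apply]⟩
  · rintro ⟨k, hk, rfl⟩
    exact p_eq hk ▸ (e.symm ⟨k, hk⟩).2
  · rw [p_eq hi, p_eq hj]
    exact (e.symm.map_adj_iff (v := ⟨i, hi⟩) (w := ⟨j, hj⟩)).trans SimpleGraph.pathGraph_adj

theorem IsHalin.exists_deg_ne_one (H : IsHalin G T C) : ∃ x, deg T x ≠ 1 := by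
  by_contra! all
  obtain ⟨y, hy⟩ := exists_adj_of_deg_eq_one (all r)
  exact H.not_adj_of_leaf (all r) (all y) hy

namespace InducesPath

variable {p : ℕ → V} {a b : V}

theorem exists_end_leaves (hp : InducesPath T {v | deg T v ≠ 1} n p) (h₀ : n ≠ 0)
    (h₃ : ∀ v, deg T v ≠ 1 → deg T v = 3) :
    ∃ a b, a ≠ b ∧ T.Adj (p 0) a ∧ deg T a = 1 ∧ T.Adj (p (n - 1)) b ∧ deg T b = 1 := by
  have hdeg : ∀ k < n, deg T (p k) = 3 := fun k hk => h₃ _ ((hp.mem_iff _).2 ⟨k, hk, rfl⟩)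
  have leaf_of_adj : ∀ {i x}, i < n → T.Adj (p i) x →
      (∀ k < n, i + 1 = k ∨ k + 1 = i → x ≠ p k) → deg T x = 1 := fun {i x} hi hx hne => by
    by_contra h
    obtain ⟨k, hk, rfl⟩ := (hp.mem_iff x).1 h
    exact hne k hk ((hp.adj_iff i hi k hk).1 hx) rfl
  obtain ⟨a, ha, ha₁, -⟩ := exists_adj_ne_ne (hdeg 0 (by omega)) (p 1) (p 1)
  obtain ⟨b, hb, hb₁, hab⟩ := exists_adj_ne_ne (hdeg (n - 1) (by omega)) (p (n - 2)) a
  refine ⟨a, b, hab.symm, ha, leaf_of_adj (by omega) ha ?_, hb, leaf_of_adj (by omega) hb ?_⟩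
  · intro k _ hk
    obtain rfl : k = 1 := by omega
    exact ha₁
  · intro k _ hk
    obtain rfl : k = n - 2 := by omega
    exact hb₁

theorem exists_isSpine (hp : InducesPath T {v | deg T v ≠ 1} n p) (h₀ : n ≠ 0) (hab : a ≠ b)
    (ha : T.Adj (p 0) a) (hda : deg T a = 1) (hb : T.Adj (p (n - 1)) b) (hdb : deg T b = 1) :
    ∃ w, IsSpine T n w := by
  let w : ℕ → V
    | 0 => a
    | k + 1 => if k < n then p k else b
  have w_succ : ∀ {k}, k < n → w (k + 1) = p k := fun h => if_pos h
  have w_last : w (n + 1) = b := if_neg (lt_irrefl n)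
  have hdeg : ∀ k < n, deg T (p k) ≠ 1 := fun k hk => (hp.mem_iff _).2 ⟨k, hk, rfl⟩
  refine ⟨w, ?_, ?_, hda, w_last ▸ hdb, fun i hi => w_succ hi ▸ hdeg i hi, ?_, ?_⟩
  · rintro (_ | i) hi
    · exact w_succ (Nat.pos_of_ne_zero h₀) ▸ ha.symm
    · rw [w_succ hi]
      rcases (Nat.succ_le_of_lt hi).lt_or_eq with hin | rfl
      · exact w_succ hin ▸ (hp.adj_iff i hi (i + 1) hin).2 (.inl rfl)
      · exact w_last ▸ hb
  · have hpa : ∀ k < n, a ≠ p k := fun k hk h => hdeg k hk (h ▸ hda)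
    have hpb : ∀ k < n, b ≠ p k := fun k hk h => hdeg k hk (h ▸ hdb)
    have hinj := hp.injOn
    rintro (_ | i) hi (_ | j) hj h <;> simp only [Set.mem_Iic, w] at hi hj h <;> grind [Set.InjOn]
  · intro x hx
    obtain ⟨k, hk, rfl⟩ := (hp.mem_iff x).1 hx
    exact ⟨k, hk, (w_succ hk).symm⟩
  · intro i hi j hj h
    rw [w_succ hi, w_succ hj, hp.adj_iff i hi j hj] at h
    omega

end InducesPath

theorem IsCubicHalin.exists_isSpine (H : IsCubicHalin G T C) (hT : IsCaterpillar T) :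
    ∃ n w, n ≠ 0 ∧ IsSpine T n w := by
  have : Nonempty V := ⟨r⟩
  obtain ⟨-, n, ⟨e⟩⟩ := hT
  obtain ⟨p, hp⟩ := exists_inducesPath e
  have h₀ : n ≠ 0 := by
    rintro rfl
    obtain ⟨x, hx⟩ := H.isHalin.exists_deg_ne_one
    obtain ⟨k, hk, -⟩ := (hp.mem_iff x).1 hx
    exact k.not_lt_zero hk
  obtain ⟨a, b, hab, ha, hda, hb, hdb⟩ := hp.exists_end_leaves h₀ H.deg_eq_three
  obtain ⟨w, hw⟩ := hp.exists_isSpine h₀ hab ha hda hb hdb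
  exact ⟨n, w, h₀, hw⟩

theorem IsSpine.exists_isComb (H : IsCubicHalin G T C) (hw : IsSpine T n w) :
    ∃ l, IsComb T n w l := by
  have third : ∀ i, ∃ z, i < n → z ≠ w i ∧ z ≠ w (i + 2) ∧
      T.neighborSet (w (i + 1)) = {w i, w (i + 2), z} := fun i => by
    by_cases hi : i < n
    · have hne : w i ≠ w (i + 2) := fun h => by
        have := hw.injOn (Set.mem_Iic.2 (by omega)) (Set.mem_Iic.2 (by omega)) h
        omega
      obtain ⟨z, hz⟩ := exists_third_neighbor (H.deg_eq_three _ (hw.deg_inner i hi))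
        (hw.adj i hi.le).symm (hw.adj (i + 1) hi) hne
      exact ⟨z, fun _ => hz⟩
    · exact ⟨r, fun h => absurd h hi⟩
  choose l hl using third
  refine ⟨l, hw, fun i hi => ?_, fun i hi => ⟨(hl i hi).1, (hl i hi).2.1⟩,
    fun i hi => (hl i hi).2.2⟩
  by_contra h
  obtain ⟨j, hj, hlj⟩ := hw.cover _ h
  have hadj : T.Adj (w (i + 1)) (l i) := (hl i hi).2.2.superset (by simp)
  rcases hw.succ_of_adj i hi j hj (hlj ▸ hadj) with rfl | rfl
  exacts [(hl i hi).2.1 hlj, (hl _ hi).1 hlj]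

/-- The embedding of the vertices of `strandGraph` in a comb. -/
def place (w l : ℕ → V) : Fin (n + 2) ⊕ Fin n → V
  | .inl i => w i
  | .inr i => l i

namespace IsComb

variable {x y : V} {i : ℕ}

theorem adj_leaf (hT : IsComb T n w l) (hi : i < n) : T.Adj (w (i + 1)) (l i) :=
  (hT.neighborSet i hi).superset (by simp)

theorem place_injective (hT : IsComb T n w l) :
    Function.Injective (place w l : Fin (n + 2) ⊕ Fin n → V) := by
  have hinj : ∀ {i j}, i ≤ n + 1 → j ≤ n + 1 → w i = w j → i = j := fun hi hj => hT.injOn hi hj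
  have hne : ∀ i ≤ n + 1, ∀ j < n, w i ≠ l j := fun i hi j hj h => by
    have hl := h.symm ▸ hT.deg_leaf j hj
    have hj' := h.symm ▸ (hT.adj_leaf hj).symm
    rcases Nat.lt_or_ge n i with hin | hin
    · obtain rfl : i = n + 1 := by omega
      have := hinj (by omega) (by omega) (eq_of_deg_eq_one hl (hT.adj n le_rfl).symm hj')
      subst this
      exact (hT.leaf_ne j hj).2 h.symm
    · have := hinj (by omega) (by omega) (eq_of_deg_eq_one hl (hT.adj i hin) hj')
      obtain rfl : i = j := by omega
      exact (hT.leaf_ne i hj).1 h.symm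
  rintro (i | i) (j | j) h
  · exact congrArg _ (Fin.ext (hinj (by omega) (by omega) h))
  · exact absurd h (hne i (by omega) j j.isLt)
  · exact absurd h.symm (hne j (by omega) i i.isLt)
  · have hi := hT.adj_leaf i.isLt
    have hj := hT.adj_leaf j.isLt
    have := hinj (by omega) (by omega) (eq_of_deg_eq_one (hT.deg_leaf i i.isLt) hi.symm
      (show T.Adj (l i) _ from (show l i = l j from h) ▸ hj.symm))
    exact congrArg _ (Fin.ext (by omega))

theorem place_surjective (H : IsHalin G T C) (hT : IsComb T n w l) :
    Function.Surjective (place w l : Fin (n + 2) ⊕ Fin n → V) := by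
  intro x
  by_cases hx : deg T x = 1
  · obtain ⟨y, hy⟩ := exists_adj_of_deg_eq_one hx
    obtain ⟨i, hi, rfl⟩ := hT.cover y fun hy₁ => H.not_adj_of_leaf hx hy₁ hy
    rcases (hT.neighborSet i hi).subset hy.symm with rfl | rfl | rfl
    exacts [⟨.inl ⟨i, by omega⟩, rfl⟩, ⟨.inl ⟨i + 2, by omega⟩, rfl⟩, ⟨.inr ⟨i, hi⟩, rfl⟩]
  · obtain ⟨i, hi, rfl⟩ := hT.cover x hx
    exact ⟨.inl ⟨i + 1, by omega⟩, rfl⟩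

theorem sym2_eq_of_adj (H : IsHalin G T C) (hT : IsComb T n w l) (h : T.Adj x y) :
    (∃ i ≤ n, s(x, y) = s(w i, w (i + 1))) ∨ ∃ i < n, s(x, y) = s(w (i + 1), l i) := by
  have inner : ∀ {x y}, T.Adj x y → deg T x ≠ 1 →
      (∃ i ≤ n, s(x, y) = s(w i, w (i + 1))) ∨ ∃ i < n, s(x, y) = s(w (i + 1), l i) := by
    intro x y h hx
    obtain ⟨i, hi, rfl⟩ := hT.cover x hx
    rcases (hT.neighborSet i hi).subset h with rfl | rfl | rfl
    exacts [.inl ⟨i, hi.le, Sym2.eq_swap⟩, .inl ⟨i + 1, hi, rfl⟩, .inr ⟨i, hi, rfl⟩]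
  by_cases hx : deg T x = 1
  · rw [Sym2.eq_swap]
    exact inner h.symm fun hy => H.not_adj_of_leaf hx hy h
  · exact inner h hx

end IsComb

end Comb

section CombFaces

variable {V : Type*} {G T : SimpleGraph V} {r : V} {C : G.Walk r r} {n : ℕ} {w l : ℕ → V}
  {s : Fin n → Bool} {σ : Option Bool} {b : Bool} {x y : Fin (n + 2) ⊕ Fin n} {i : ℕ}

/-! ### The faces along a comb -/

theorem exists_consecutive_across (s : Fin n → Bool) (σ : Option Bool) (hi : i ≤ n) :
    ∃ x y, Consecutive s σ x y ∧ pos x ≤ i ∧ i < pos y := by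
  let left := Finset.univ.filter fun z => OnStrand s σ z ∧ pos z ≤ i
  let right := Finset.univ.filter fun z => OnStrand s σ z ∧ i < pos z
  have mem_left : ∀ {z}, z ∈ left ↔ OnStrand s σ z ∧ pos z ≤ i := by
    simp only [left, Finset.mem_filter_univ, implies_true]
  have mem_right : ∀ {z}, z ∈ right ↔ OnStrand s σ z ∧ i < pos z := by
    simp only [right, Finset.mem_filter_univ, implies_true]
  obtain ⟨x, hx, hmax⟩ := left.exists_max_image pos
    ⟨.inl 0, mem_left.2 ⟨.inr (.inl rfl), i.zero_le⟩⟩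
  obtain ⟨y, hy, hmin⟩ := right.exists_min_image pos
    ⟨.inl (Fin.last (n + 1)), mem_right.2 ⟨.inr (.inr rfl), Nat.lt_succ_of_le hi⟩⟩
  obtain ⟨hx, hxi⟩ := mem_left.1 hx
  obtain ⟨hy, hyi⟩ := mem_right.1 hy
  refine ⟨x, y, ⟨hx, hy, hxi.trans_lt hyi, fun z hz => ?_⟩, hxi, hyi⟩
  exact (Nat.lt_or_ge i (pos z)).symm.imp (fun h => hmax z (mem_left.2 ⟨hz, h⟩))
    fun h => hmin z (mem_right.2 ⟨hz, h⟩)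

theorem OnStrand.exists_consecutive_right (hx : OnStrand s σ x) (h : pos x ≤ n) :
    ∃ y, Consecutive s σ x y := by
  obtain ⟨x', y, hc, hx', hy⟩ := exists_consecutive_across s σ h
  obtain rfl : x' = x := hc.1.eq_of_pos_eq hx (by have := hc.2.2.2 x hx; omega)
  exact ⟨y, hc⟩

theorem OnStrand.exists_consecutive_left (hx : OnStrand s σ x) (h : 0 < pos x) :
    ∃ y, Consecutive s σ y x := by
  obtain ⟨y, x', hc, hy, hx'⟩ :=
    exists_consecutive_across s σ (i := pos x - 1) (by have := pos_le x; omega)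
  obtain rfl : x' = x := hc.2.1.eq_of_pos_eq hx (by have := hc.2.2.2 x hx; omega)
  exact ⟨y, hc⟩

/-- At the vertex `w (i + 1)` the leaf `l i` lies on the side `s i` of the spine: the facial walks
on that side make a detour to the leaf, while those on the other side follow the spine. -/
structure HasSides (R : RotationSystem G) (w l : ℕ → V) (s : Fin n → Bool) : Prop where
  to_leaf : ∀ i : Fin n, R.SameFaceAlong (s i) (w i) (w (i + 1)) (w (i + 1)) (l i)
  from_leaf : ∀ i : Fin n, R.SameFaceAlong (s i) (l i) (w (i + 1)) (w (i + 1)) (w (i + 2))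
  along_spine : ∀ i : Fin n, R.SameFaceAlong (!s i) (w i) (w (i + 1)) (w (i + 1)) (w (i + 2))

theorem IsComb.exists_hasSides (H : IsHalin G T C) (hT : IsComb T n w l) (R : RotationSystem G) :
    ∃ s : Fin n → Bool, HasSides R w l s := by
  have turns : ∀ i : Fin n, ∃ b : Bool,
      R.SameFaceAlong b (w i) (w (i + 1)) (w (i + 1)) (l i) ∧
      R.SameFaceAlong b (l i) (w (i + 1)) (w (i + 1)) (w (i + 2)) ∧
      R.SameFaceAlong (!b) (w i) (w (i + 1)) (w (i + 1)) (w (i + 2)) := by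
    intro ⟨i, hi⟩
    have hN := (H.neighborSet_inner (hT.deg_inner i hi)).trans (hT.neighborSet i hi)
    obtain ⟨hl, hl'⟩ := hT.leaf_ne i hi
    have hne : w i ≠ w (i + 2) := fun h => by
      have := hT.injOn (Set.mem_Iic.2 (by omega)) (Set.mem_Iic.2 (by omega)) h
      omega
    have hN' : G.neighborSet (w (i + 1)) = {w i, l i, w (i + 2)} := hN.trans (by
      rw [Set.pair_comm])
    rcases R.turn_or_turn hne hN with h | h
    · obtain ⟨h₂, h₃⟩ := h.cyclic hne hl.symm hl'.symm hN
      exact ⟨false, h₃.sameFace.symm, h₂.sameFace.symm, h.sameFace⟩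
    · obtain ⟨h₂, h₃⟩ := h.cyclic hl.symm hne hl' hN'
      exact ⟨true, h.sameFace, h₂.sameFace, h₃.sameFace.symm⟩
  choose s hs using turns
  exact ⟨s, fun i => (hs i).1, fun i => (hs i).2.1, fun i => (hs i).2.2⟩

theorem IsComb.deg_place_of_onStrand (hT : IsComb T n w l) (hx : OnStrand s (some b) x) :
    deg T (place w l x) = 1 := by
  match x, hx with
  | .inl _, .inr (.inl rfl) => exact hT.deg_zero
  | .inl _, .inr (.inr rfl) => exact hT.deg_last
  | .inr i, _ => exact hT.deg_leaf i i.isLt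

theorem IsComb.onStrand_of_deg_place (hT : IsComb T n w l) (s : Fin n → Bool)
    (hx : deg T (place w l x) = 1) :
    OnStrand s (some true) x ∧ pos x ≤ n ∨ OnStrand s (some false) x ∧ 0 < pos x := by
  match x, hx with
  | .inl i, hx =>
    rcases Nat.eq_zero_or_pos i with h₀ | h₀
    · exact .inl ⟨.inr (.inl (Fin.ext h₀)), by simp only [pos]; omega⟩
    · refine .inr ⟨.inr (.inr (Fin.ext ?_)), h₀⟩
      by_contra hlast
      rw [Fin.val_last] at hlast
      refine hT.deg_inner (i - 1) (by omega) ?_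
      rwa [Nat.sub_add_cancel h₀]
  | .inr i, _ =>
    cases hb : s i with
    | true => exact .inl ⟨congrArg some hb.symm, i.isLt⟩
    | false => exact .inr ⟨congrArg some hb.symm, i.val.succ_pos⟩

namespace HasSides

open RotationSystem

variable {R : RotationSystem G}

theorem exists_from_rail (hs : HasSides R w l s) (H : IsHalin G T C) (hT : IsComb T n w l)
    (hx : OnStrand s (some b) x) (hn : pos x ≤ n) :
    ∃ t, T.Adj (place w l x) t ∧
      R.SameFaceAlong b (place w l x) t (w (pos x)) (w (pos x + 1)) := by
  match x, hx with
  | .inl i, _ =>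
    exact ⟨w (i + 1), hT.adj i hn, .refl (H.adj_iff.2 (.inl (hT.adj i hn)))⟩
  | .inr i, hx =>
    obtain rfl := Option.some.inj hx
    exact ⟨w (i + 1), (hT.adj_leaf i.isLt).symm, hs.from_leaf i⟩

theorem exists_to_rail (hs : HasSides R w l s) (H : IsHalin G T C) (hT : IsComb T n w l)
    (hy : OnStrand s (some b) y) (hi : pos y = i + 1) :
    ∃ t, T.Adj t (place w l y) ∧ R.SameFaceAlong b (w i) (w (i + 1)) t (place w l y) := by
  match y, hy with
  | .inl j, _ =>
    have hT' := hT.adj i (by have := pos_le (.inl j : Fin (n + 2) ⊕ Fin n); omega)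
    rw [show place w l (.inl j) = w (i + 1) from congrArg w hi]
    exact ⟨w i, hT', .refl (H.adj_iff.2 (.inl hT'))⟩
  | .inr j, hy =>
    obtain rfl : i = j := by simpa [pos] using hi.symm
    obtain rfl := Option.some.inj hy
    exact ⟨w (j + 1), hT.adj_leaf j.isLt, hs.to_leaf j⟩

theorem along_gaps (hs : HasSides R w l s) (H : IsHalin G T C) (hT : IsComb T n w l) {j : ℕ}
    (hij : i ≤ j) (hj : j ≤ n) (hgap : ∀ z, OnStrand s (some b) z → pos z ≤ i ∨ j < pos z) :
    R.SameFaceAlong b (w i) (w (i + 1)) (w j) (w (j + 1)) := by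
  induction j, hij using Nat.le_induction with
  | base => exact .refl (H.adj_iff.2 (.inl (hT.adj i hj)))
  | succ j hij ih =>
    have hopp : (!s ⟨j, hj⟩) = b := by
      by_contra hb
      have := hgap (.inr ⟨j, hj⟩) (congrArg some (by simpa [eq_comm] using hb))
      simp only [pos] at this
      omega
    refine (ih (by omega) fun z hz => (hgap z hz).imp_right fun h => by omega).trans ?_
    exact hopp ▸ hs.along_spine ⟨j, hj⟩

theorem exists_to_gap (hs : HasSides R w l s) (H : IsHalin G T C) (hT : IsComb T n w l)
    (hc : Consecutive s (some b) x y) (hx : pos x ≤ i) (hy : i < pos y) :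
    ∃ t, T.Adj (place w l x) t ∧ R.SameFaceAlong b (place w l x) t (w i) (w (i + 1)) := by
  have hn := pos_le y
  obtain ⟨t, ht, h⟩ := hs.exists_from_rail H hT hc.1 (by omega)
  exact ⟨t, ht, h.trans (hs.along_gaps H hT hx (by omega) fun z hz =>
    (hc.2.2.2 z hz).imp_right hy.trans_le)⟩

theorem exists_from_gap (hs : HasSides R w l s) (H : IsHalin G T C) (hT : IsComb T n w l)
    (hc : Consecutive s (some b) x y) (hx : pos x ≤ i) (hy : i < pos y) :
    ∃ t, T.Adj t (place w l y) ∧ R.SameFaceAlong b (w i) (w (i + 1)) t (place w l y) := by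
  have hn := pos_le y
  obtain ⟨j, hj⟩ : ∃ j, pos y = j + 1 := Nat.exists_eq_succ_of_ne_zero (by omega)
  obtain ⟨t, ht, h⟩ := hs.exists_to_rail H hT hc.2.1 hj
  exact ⟨t, ht, (hs.along_gaps H hT (by omega) (by omega) fun z hz =>
    (hc.2.2.2 z hz).imp hx.trans' fun h => by omega).trans h⟩

theorem exits_of_gap (hs : HasSides R w l s) (H : IsHalin G T C) (hT : IsComb T n w l)
    (hi : i ≤ n) :
    (∃ z t, deg T z = 1 ∧ T.Adj t z ∧ R.SameFace (w i) (w (i + 1)) t z) ∧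
      ∃ z t, deg T z = 1 ∧ T.Adj t z ∧ R.SameFace (w (i + 1)) (w i) t z := by
  constructor
  · obtain ⟨x, y, hc, hx, hy⟩ := exists_consecutive_across s (some true) hi
    obtain ⟨t, ht, h⟩ := hs.exists_from_gap H hT hc hx hy
    exact ⟨_, t, hT.deg_place_of_onStrand hc.2.1, ht, h⟩
  · obtain ⟨x, y, hc, hx, hy⟩ := exists_consecutive_across s (some false) hi
    obtain ⟨t, ht, h⟩ := hs.exists_to_gap H hT hc hx hy
    exact ⟨_, t, hT.deg_place_of_onStrand hc.1, ht.symm, SameFace.symm h⟩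

theorem exits (hs : HasSides R w l s) (H : IsHalin G T C) (hT : IsComb T n w l) {u v : V}
    (huv : T.Adj u v) : ∃ z t, deg T z = 1 ∧ T.Adj t z ∧ R.SameFace u v t z := by
  rcases hT.sym2_eq_of_adj H huv with ⟨i, hi, he⟩ | ⟨i, hi, he⟩ <;>
    rcases Sym2.eq_iff.1 he with ⟨rfl, rfl⟩ | ⟨rfl, rfl⟩
  · exact (hs.exits_of_gap H hT hi).1
  · exact (hs.exits_of_gap H hT hi).2
  · exact ⟨_, _, hT.deg_leaf i hi, huv, .refl (H.adj_iff.2 (.inl huv))⟩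
  · cases hb : s ⟨i, hi⟩ with
    | true =>
      obtain ⟨z, t, hz, ht, h⟩ := (hs.exits_of_gap H hT (i := i + 1) hi).1
      have hl := hs.from_leaf ⟨i, hi⟩
      rw [hb] at hl
      exact ⟨z, t, hz, ht, SameFace.trans hl h⟩
    | false =>
      obtain ⟨z, t, hz, ht, h⟩ := (hs.exits_of_gap H hT hi.le).2
      have hl := hs.to_leaf ⟨i, hi⟩
      rw [hb] at hl
      exact ⟨z, t, hz, ht, SameFace.trans (SameFace.symm hl) h⟩

variable [Finite V] {d₀ : G.Dart}

theorem rimStep_of_consecutive_true (hs : HasSides R w l s) (H : IsHalin G T C)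
    (hT : IsComb T n w l) (hR : R.IsPlane) (hd₀ : ∀ d, d ∈ C.darts ↔ R.faceMap.SameCycle d₀ d)
    (hc : Consecutive s (some true) x y) : RimStep C (place w l x) (place w l y) := by
  obtain ⟨t, ht, h⟩ := hs.exists_to_gap H hT hc le_rfl hc.2.2.1
  obtain ⟨t', ht', h'⟩ := hs.exists_from_gap H hT hc le_rfl hc.2.2.1
  exact H.rimStep_of_sameFace hR hd₀ (hs.exits H hT) (hT.deg_place_of_onStrand hc.1)
    (hT.deg_place_of_onStrand hc.2.1) ht ht' (h.trans h')

theorem rimStep_of_consecutive_false (hs : HasSides R w l s) (H : IsHalin G T C)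
    (hT : IsComb T n w l) (hR : R.IsPlane) (hd₀ : ∀ d, d ∈ C.darts ↔ R.faceMap.SameCycle d₀ d)
    (hc : Consecutive s (some false) x y) : RimStep C (place w l y) (place w l x) := by
  obtain ⟨t, ht, h⟩ := hs.exists_to_gap H hT hc le_rfl hc.2.2.1
  obtain ⟨t', ht', h'⟩ := hs.exists_from_gap H hT hc le_rfl hc.2.2.1
  exact H.rimStep_of_sameFace hR hd₀ (hs.exits H hT) (hT.deg_place_of_onStrand hc.2.1)
    (hT.deg_place_of_onStrand hc.1) ht'.symm ht.symm (SameFace.symm (h.trans h'))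

theorem consecutive_of_rimStep (hs : HasSides R w l s) (H : IsHalin G T C)
    (hT : IsComb T n w l) (hR : R.IsPlane) (hd₀ : ∀ d, d ∈ C.darts ↔ R.faceMap.SameCycle d₀ d)
    (h : RimStep C (place w l x) (place w l y)) :
    Consecutive s (some true) x y ∨ Consecutive s (some false) y x := by
  rcases hT.onStrand_of_deg_place s (H.deg_eq_one_of_rimStep h).1 with ⟨hx, hn⟩ | ⟨hx, h₀⟩
  · obtain ⟨z, hz⟩ := hx.exists_consecutive_right hn
    have := H.rimStep_right_unique h (hs.rimStep_of_consecutive_true H hT hR hd₀ hz)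
    exact .inl (hT.place_injective this ▸ hz)
  · obtain ⟨z, hz⟩ := hx.exists_consecutive_left h₀
    have := H.rimStep_right_unique h (hs.rimStep_of_consecutive_false H hT hR hd₀ hz)
    exact .inr (hT.place_injective this ▸ hz)

end HasSides

theorem consecutive_none (s : Fin n → Bool) (i : Fin (n + 1)) :
    Consecutive s none (.inl i.castSucc) (.inl i.succ) :=
  ⟨.inl rfl, .inl rfl, i.val.lt_succ_self, fun z _ => Nat.lt_or_ge i (pos z) |>.symm⟩

namespace IsComb

theorem adj_place_of_pos_eq (hT : IsComb T n w l) (hne : x ≠ y) (hpos : pos x = pos y) :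
    T.Adj (place w l x) (place w l y) := by
  have rung : ∀ {i j}, pos (.inl i : Fin (n + 2) ⊕ Fin n) = pos (.inr j : Fin (n + 2) ⊕ Fin n) →
      T.Adj (w i) (l j) := fun {i j} h => by
    rw [show w i = w (j + 1) from congrArg w h]
    exact hT.adj_leaf j.isLt
  match x, y with
  | .inl i, .inl j => exact absurd (congrArg Sum.inl (Fin.ext hpos)) hne
  | .inl i, .inr j => exact rung hpos
  | .inr i, .inl j => exact (rung hpos.symm).symm
  | .inr i, .inr j => exact absurd (congrArg Sum.inr (Fin.ext (Nat.succ.inj hpos))) hne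

theorem adj_place_of_consecutive (hT : IsComb T n w l) (hc : Consecutive s none x y) :
    T.Adj (place w l x) (place w l y) := by
  match x, hc with
  | .inl i, hc =>
    have hi : (i : ℕ) ≤ n := Nat.le_of_lt_succ (hc.2.2.1.trans_le (pos_le y))
    rw [hc.right_unique (consecutive_none s ⟨i, Nat.lt_succ_of_le hi⟩)]
    exact hT.adj i hi
  | .inr _, hc => cases hc.1

theorem pos_eq_or_consecutive_of_adj (H : IsHalin G T C) (hT : IsComb T n w l) (s : Fin n → Bool)
    (h : T.Adj (place w l x) (place w l y)) :
    (x ≠ y ∧ pos x = pos y) ∨ Consecutive s none x y ∨ Consecutive s none y x := by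
  have hinj := Sym2.map.injective hT.place_injective
  rcases hT.sym2_eq_of_adj H h with ⟨i, hi, he⟩ | ⟨i, hi, he⟩
  · have hxy := @hinj s(x, y) s(.inl (Fin.castSucc ⟨i, by omega⟩), .inl (Fin.succ ⟨i, by omega⟩)) he
    rcases Sym2.eq_iff.1 hxy with ⟨rfl, rfl⟩ | ⟨rfl, rfl⟩
    exacts [.inr (.inl (consecutive_none s _)), .inr (.inr (consecutive_none s _))]
  · have hxy := @hinj s(x, y) s(.inl ⟨i + 1, by omega⟩, .inr ⟨i, hi⟩) he
    rcases Sym2.eq_iff.1 hxy with ⟨rfl, rfl⟩ | ⟨rfl, rfl⟩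
    exacts [.inl ⟨Sum.inl_ne_inr, rfl⟩, .inl ⟨Sum.inr_ne_inl, rfl⟩]

end IsComb

theorem HasSides.strandGraph_adj_iff [Finite V] {R : RotationSystem G} {d₀ : G.Dart}
    (hs : HasSides R w l s) (H : IsHalin G T C) (hT : IsComb T n w l) (hR : R.IsPlane)
    (hd₀ : ∀ d, d ∈ C.darts ↔ R.faceMap.SameCycle d₀ d) :
    G.Adj (place w l x) (place w l y) ↔ (strandGraph s).Adj x y := by
  have rim : ∀ {x y} b, Consecutive s (some b) x y →
      RimStep C (place w l x) (place w l y) ∨ RimStep C (place w l y) (place w l x)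
    | _, _, true, h => .inl (hs.rimStep_of_consecutive_true H hT hR hd₀ h)
    | _, _, false, h => .inr (hs.rimStep_of_consecutive_false H hT hR hd₀ h)
  rw [H.adj_iff]
  constructor
  · rintro (h | h | h)
    · exact (hT.pos_eq_or_consecutive_of_adj H s h).imp_right fun h => ⟨none, h⟩
    · exact .inr ((hs.consecutive_of_rimStep H hT hR hd₀ h).elim (⟨_, .inl ·⟩) (⟨_, .inr ·⟩))
    · exact .inr ((hs.consecutive_of_rimStep H hT hR hd₀ h).elim (⟨_, .inr ·⟩) (⟨_, .inl ·⟩))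
  · rintro (⟨hne, hpos⟩ | ⟨_ | b, h | h⟩)
    · exact .inl (hT.adj_place_of_pos_eq hne hpos)
    · exact .inl (hT.adj_place_of_consecutive h)
    · exact .inl (hT.adj_place_of_consecutive h).symm
    · exact .inr (rim b h)
    · exact .inr (rim b h).symm

theorem IsCubicHalin.exists_iso_strandGraph [Finite V] (H : IsCubicHalin G T C)
    (hT : IsCaterpillar T) : ∃ n ≠ 0, ∃ s : Fin n → Bool, Nonempty (strandGraph s ≃g G) := by
  obtain ⟨n, w, hn, hw⟩ := H.exists_isSpine hT
  obtain ⟨l, hl⟩ := hw.exists_isComb H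
  obtain ⟨R, hR, d₀, hd₀⟩ := H.isHalin.plane
  obtain ⟨s, hs⟩ := hl.exists_hasSides H.isHalin R
  have bij := And.intro hl.place_injective (hl.place_surjective H.isHalin)
  exact ⟨n, hn, s, ⟨⟨.ofBijective _ bij, hs.strandGraph_adj_iff H.isHalin hl hR hd₀⟩⟩⟩

end CombFaces

end HalinStar

theorem theorem4p1 {V : Type*} [Finite V] (h : ℕ) (G : SimpleGraph V)
    (hG : HalinStar.CaterpillarHalin h G)
    (hne : ¬ Nonempty (G ≃g HalinStar.necklace 2)) :
    HalinStar.starChromaticIndex G = 5 := by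
  obtain ⟨T, r, C, H, hT, -⟩ := hG
  obtain ⟨n, h₀, s, ⟨e⟩⟩ := H.exists_iso_strandGraph hT
  have h₂ : n ≠ 2 := by
    rintro rfl
    obtain ⟨e'⟩ := HalinStar.nonempty_strandGraph_iso_prism s
    exact hne ⟨e.symm.trans e'⟩
  obtain ⟨c, hc⟩ := HalinStar.exists_isStarColoring_strandGraph h₀ h₂ s
  have colorable : HalinStar.StarEdgeColorable G 5 :=
    (hc.comap e.symm.toHom e.symm.injective).starEdgeColorable
  obtain ⟨x, y, z, hxy, hyz, hzx⟩ := HalinStar.exists_triangle_strandGraph h₀ s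
  have five_le : ∀ k, HalinStar.StarEdgeColorable G k → 5 ≤ k := fun k =>
    HalinStar.five_le_of_starEdgeColorable_of_triangle H.deg_eq (e.map_adj_iff.2 hxy)
      (e.map_adj_iff.2 hyz) (e.map_adj_iff.2 hzx)
  exact le_antisymm (Nat.sInf_le colorable) (le_csInf ⟨5, colorable⟩ five_le)
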